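/- Let $J:\mathbb R\to[0,\infty)$ be an even, integrable, compactly supported function that is non-increasing on $(0,\infty)$, and put $\widehat J=\int_{\mathbb R}J(s)\,ds$. Let $\beta>0$ and $\lambda\in\mathbb R$. For $m,n\ge 0$ let $$f(m,n)=m\ln m+n\ln n+\beta\widehat J\,mn-\lambda m-\lambda n\qquad(0\ln 0=0),\qquad g=\inf_{m,n\ge0}f(m,n).$$ Assume that the two-phase regime holds: there are densities $0\le\rho^-<\rho^+$ such that $(\rho^-,\rho^+)$ and $(\rho^+,\rho^-)$ both minimize $f$ over $[0,\infty)^2$. The excess free energy of a front is $$\mathcal G(m,n)=\int_{\mathbb R}\Big[m(x)\ln m(x)+n(x)\ln n(x)+\beta\int_{\mathbb R}J(x-y)m(x)n(y)\,dy-\lambda\,(m(x)+n(x))-g\Big]dx .$$ Let $\mathcal M_{\rho^-,\rho^+}$ be the set of monotone increasing $m:\mathbb R\to\mathbb R$ with $m(x)\to\rho^{\pm}$ as $x\to\pm\infty$, and $\mathcal M_{\rho^+,\rho^-}$ the set of monotone decreasing $n:\mathbb R\to\mathbb R$ with $n(x)\to\rho^{\mp}$ as $x\to\pm\infty$. A pair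 $(w_1,w_2)\in\mathcal M_{\rho^-,\rho^+}\times\mathcal M_{\rho^+,\rho^-}$ is called a critical point of $\mathcal G$ if its first variation vanishes there: for all $\varphi,\psi\in C_c^\infty(\mathbb R)$, $$\frac{d}{d\varepsilon}\Big|_{\varepsilon=0}\big[\mathcal G(w_1+\varepsilon\varphi,w_2+\varepsilon\psi)-\mathcal G(w_1,w_2)\big]=0,$$ where the difference in brackets is understood as the integral over $\mathbb R$ of the difference of the two integrands (which converges for small $|\varepsilon|$, whether or not $\mathcal G(w_1,w_2)$ is finite). **Theorem.** At every critical point of $\mathcal G$ in $\mathcal M_{\rho^-,\rho^+}\times\mathcal M_{\rho^+,\rho^-}$ the integrand of $\mathcal G$ is integrable, so that $\mathcal G$ is finite there. If $(w_1,w_2)$ and $(v_1,v_2)$ are any two critical points of $\mathcal G$ in $\mathcal M_{\rho^-,\rho^+}\times\mathcal M_{\rho^+,\rho^-}$, then there is an $a\in\mathbb R$ such that $$(v_1(x),v_2(x))=(w_1(x-a),w_2(x-a))\qquad\text{for all }x\in\mathbb R.$$ There is exactly one critical point $(w_1,w_2)$ with $w_1(0)=w_2(0)$, and it is symmetric: $w_1(x)=w_2(-x)$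 for all $x\in\mathbb R$. -/

import Mathlib

open MeasureTheory Filter Topology Set

noncomputable section

namespace BinaryFluid

/-- The local Gibbs free energy density
`f(m, n) = m ln m + n ln n + β Ĵ m n - lam m - lam n` (with `0 ln 0 = 0`). -/
def localFreeEnergy (β Jhat lam m n : ℝ) : ℝ :=
  m * Real.log m + n * Real.log n + β * Jhat * m * n - lam * m - lam * n

/-- `g = inf_{m, n ≥ 0} f(m, n)`. -/
def minLocalFreeEnergy (β Jhat lam : ℝ) : ℝ :=
  sInf ((fun p : ℝ × ℝ => localFreeEnergy β Jhat lam p.1 p.2) '' (Ici 0 ×ˢ Ici 0))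

/-- The integrand of the excess free energy functional, at the point `x`. -/
def excessDensity (J : ℝ → ℝ) (β lam : ℝ) (m n : ℝ → ℝ) (x : ℝ) : ℝ :=
  m x * Real.log (m x) + n x * Real.log (n x)
    + β * (∫ y, J (x - y) * m x * n y)
    - lam * (m x + n x)
    - minLocalFreeEnergy β (∫ s, J s) lam

/-- The excess free energy of a front (meaningful when the density is integrable). -/
def excessFreeEnergy (J : ℝ → ℝ) (β lam : ℝ) (m n : ℝ → ℝ) : ℝ :=
  ∫ x, excessDensity J β lam m n x

/-- The energy difference `𝒢(m', n') - 𝒢(m, n)`, written as a single integral. For compactly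
supported perturbations of a profile it converges whether or not `𝒢(m, n)` is finite. -/
def excessDifference (J : ℝ → ℝ) (β lam : ℝ) (m n m' n' : ℝ → ℝ) : ℝ :=
  ∫ x, (excessDensity J β lam m' n' x - excessDensity J β lam m n x)

/-- Where the two energies are finite, `excessDifference` is their difference. -/
theorem excessDifference_eq_sub {J : ℝ → ℝ} {β lam : ℝ} {m n m' n' : ℝ → ℝ}
    (h : Integrable (excessDensity J β lam m n))
    (h' : Integrable (excessDensity J β lam m' n')) :
    excessDifference J β lam m n m' n'
      = excessFreeEnergy J β lam m' n' - excessFreeEnergy J β lam m n :=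
  integral_sub h' h

/-- `𝒞_{a,b}`: measurable profiles with limit `a` at `-∞` and limit `b` at `+∞`. -/
def profiles (a b : ℝ) : Set (ℝ → ℝ) :=
  {m | Measurable m ∧ Tendsto m atBot (𝓝 a) ∧ Tendsto m atTop (𝓝 b)}

/-- `ℳ_{a,b}` for `a < b`: the monotone increasing profiles. -/
def increasingProfiles (a b : ℝ) : Set (ℝ → ℝ) :=
  {m | m ∈ profiles a b ∧ Monotone m}

/-- `ℳ_{b,a}` for `a < b`: the monotone decreasing profiles, from `b` at `-∞` to `a` at `+∞`. -/
def decreasingProfiles (b a : ℝ) : Set (ℝ → ℝ) :=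
  {m | m ∈ profiles b a ∧ Antitone m}

/-- `(w₁, w₂)` is a critical point of `𝒢` in `ℳ_{ρ⁻,ρ⁺} × ℳ_{ρ⁺,ρ⁻}`: it belongs to this set and
the first variation of `𝒢` at it vanishes in the direction of every pair of test functions. -/
def IsCriticalPoint (J : ℝ → ℝ) (β lam ρm ρp : ℝ) (w₁ w₂ : ℝ → ℝ) : Prop :=
  w₁ ∈ increasingProfiles ρm ρp ∧ w₂ ∈ decreasingProfiles ρp ρm ∧
  ∀ φ ψ : ℝ → ℝ,
    ContDiff ℝ (⊤ : ℕ∞) φ → HasCompactSupport φ →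
    ContDiff ℝ (⊤ : ℕ∞) ψ → HasCompactSupport ψ →
    HasDerivAt
      (fun ε : ℝ => excessDifference J β lam w₁ w₂
        (fun x => w₁ x + ε * φ x) (fun x => w₂ x + ε * ψ x)) 0 0

end BinaryFluid

end

/-! Critical points are the monotone solutions of `u = Φ(J * v)`, `v = Φ(J * u)` with `Φ = response
β lam`, joining the two phases. `isCriticalPoint_iff` proves this with the fundamental lemma of the
calculus of variations; monotonicity upgrades the equations from almost everywhere to everywhere.
Since `Φ` is decreasing, the system preserves the order in which `u` goes up and `v` goes down.

Constants. Eliminating the second density from the local free energy leaves a function of one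
variable, `wellEnergy`. Its inflection points lie where the strictly concave logarithm meets a line,
so there are at most two of them. Rolle's theorem then shows that it vanishes only at the two phases
on `[ρm, ρp]`, and that `(β Ĵ)² ρm ρp < 1`: the linearized system is a contraction at each pure
phase.

Uniqueness is a sliding argument. Far from the interface the contraction damps any violation of
order, so fronts ordered on a suitable bounded interval are ordered everywhere
(`IsFront.comparison`). A front is shifted until it is minimally above another one. If they do not
touch, compactness and comparison allow a smaller shift; if they touch, the strong maximum principle
makes them equal (`IsFront.eq_of_touch`). Reflection with exchange of the species preserves fronts,
which gives symmetry, and the same contraction gives the integrable decay behind finite energy.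

Existence comes from equilibrating the species in turn, beginning with a sharp interface. Each round
lowers the energy by at least a squared Hellinger distance (`IsTransition.energy_decrease`), and the
energy is bounded below, so these distances tend to zero. Centring and Helly's theorem give a
monotone fixed point; its finite well energy forces its limits to be the two phases. -/

noncomputable section

namespace BinaryFluid

/-! ### The response function and the data of the two-phase regime -/

/-- The Euler–Lagrange response `Φ(s) = exp (lam - 1 - β s)`: the density which minimizes the free
energy when the other species exerts the potential `s`. -/
def response (β lam s : ℝ) : ℝ := Real.exp (lam - 1 - β * s)

/-- The local free energy density minimized over the second species, relative to its minimum. -/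
def wellEnergy (β Jhat lam m : ℝ) : ℝ :=
  m * Real.log m - lam * m - response β lam (Jhat * m) - minLocalFreeEnergy β Jhat lam

/-- Finite-range, even, integrable, radially non-increasing interaction kernels. -/
structure IsKernel (J : ℝ → ℝ) (L : ℝ) : Prop where
  nonneg : ∀ x, 0 ≤ J x
  even : ∀ x, J (-x) = J x
  anti : AntitoneOn J (Ioi 0)
  integrable : Integrable J
  range_pos : 0 < L
  supp : ∀ s, L < |s| → J s = 0

/-- What the analysis of fronts uses of the two-phase regime. -/
structure TwoPhase (J : ℝ → ℝ) (L β lam ρm ρp : ℝ) : Prop extends IsKernel J L where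
  β_pos : 0 < β
  mass_pos : 0 < ∫ s, J s
  low_pos : 0 < ρm
  low_lt_high : ρm < ρp
  response_high : response β lam ((∫ s, J s) * ρp) = ρm
  response_low : response β lam ((∫ s, J s) * ρm) = ρp
  stable : (β * ∫ s, J s) ^ 2 * ρm * ρp < 1
  well_pos : ∀ m ∈ Ioo ρm ρp, 0 < wellEnergy β (∫ s, J s) lam m
  min_eq : minLocalFreeEnergy β (∫ s, J s) lam = -ρm - ρp - β * (∫ s, J s) * ρm * ρp

theorem response_pos (β lam s : ℝ) : 0 < response β lam s := Real.exp_pos _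

theorem log_response (β lam s : ℝ) : Real.log (response β lam s) = lam - 1 - β * s :=
  Real.log_exp _

theorem response_antitone {β : ℝ} (hβ : 0 ≤ β) (lam : ℝ) : Antitone (response β lam) := by
  intro s t h
  unfold response
  gcongr

theorem response_injective {β : ℝ} (hβ : 0 < β) (lam : ℝ) :
    Function.Injective (response β lam) := by
  intro s t h
  have := Real.exp_injective h
  have h2 : β * s = β * t := by linarith
  exact mul_left_cancel₀ hβ.ne' h2

theorem continuous_response (β lam : ℝ) : Continuous (response β lam) := by
  unfold response; fun_prop

theorem hasDerivAt_response (β lam s : ℝ) :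
    HasDerivAt (response β lam) (-(β * response β lam s)) s := by
  have h : HasDerivAt (fun s : ℝ => lam - 1 - β * s) (-β) s := by
    simpa using ((hasDerivAt_id s).const_mul β).const_sub (lam - 1)
  have h' : HasDerivAt (response β lam) _ s := h.exp
  refine h'.congr_deriv ?_
  unfold response; ring

/-- The tangent line inequality for the convex function `Φ`. -/
theorem response_sub_le (β lam s t : ℝ) :
    response β lam s - response β lam t ≤ response β lam s * (β * (t - s)) := by
  have h1 : response β lam t = response β lam s * Real.exp (β * (s - t)) := by
    unfold response; rw [← Real.exp_add]; ring_nf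
  have h2 := Real.add_one_le_exp (β * (s - t))
  have := mul_le_mul_of_nonneg_left h2 (response_pos β lam s).le
  rw [h1]; linarith

theorem localFreeEnergy_response (β Jhat lam m : ℝ) :
    localFreeEnergy β Jhat lam m (response β lam (Jhat * m))
      = m * Real.log m - lam * m - response β lam (Jhat * m) := by
  unfold localFreeEnergy; rw [log_response]; ring

theorem localFreeEnergy_comm (β Jhat lam m n : ℝ) :
    localFreeEnergy β Jhat lam m n = localFreeEnergy β Jhat lam n m := by
  unfold localFreeEnergy; ring

/-! ### The double well of the local free energy -/

section Constants

variable {β Jhat lam ρm ρp : ℝ}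

/-- The logarithmic derivative of the entropy forbids zero densities at minimizers. -/
theorem pos_of_isMinOn {a b : ℝ} (ha : 0 ≤ a) (hb : 0 ≤ b)
    (hmin : IsMinOn (fun p : ℝ × ℝ => localFreeEnergy β Jhat lam p.1 p.2)
      (Ici 0 ×ˢ Ici 0) (a, b)) : 0 < a := by
  rcases ha.lt_or_eq with h | h
  · exact h
  · exfalso
    subst h
    -- With this density the energy changes by `t (log t + β Ĵ b - lam) = -t < 0` relative to
    -- density zero.
    set t := Real.exp (lam - β * Jhat * b - 1) with ht
    have htpos : 0 < t := Real.exp_pos _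
    have h1 := (isMinOn_iff.1 hmin) (t, b) ⟨htpos.le, hb⟩
    simp only [localFreeEnergy] at h1
    rw [ht, Real.log_exp, ← ht] at h1
    simp at h1
    nlinarith

/-- The Euler–Lagrange equation at a minimizer of the local free energy. -/
theorem eq_response_of_isMinOn {a b : ℝ} (ha : 0 < a) (hb : 0 ≤ b)
    (hmin : IsMinOn (fun p : ℝ × ℝ => localFreeEnergy β Jhat lam p.1 p.2)
      (Ici 0 ×ˢ Ici 0) (a, b)) : a = response β lam (Jhat * b) := by
  have hloc : IsLocalMin (fun m => localFreeEnergy β Jhat lam m b) a := by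
    filter_upwards [lt_mem_nhds ha] with m hm
    exact (isMinOn_iff.1 hmin) (m, b) ⟨hm.le, hb⟩
  have hd : HasDerivAt (fun m => localFreeEnergy β Jhat lam m b)
      (Real.log a + 1 + β * Jhat * b - lam) a := by
    unfold localFreeEnergy
    have h1 := Real.hasDerivAt_mul_log ha.ne'
    have h2 := ((hasDerivAt_id a).const_mul (β * Jhat)).mul_const b
    have h3 := (hasDerivAt_id a).const_mul lam
    refine ((((h1.add_const (b * Real.log b)).add h2).sub h3).sub_const (lam * b)).congr_deriv ?_
    ring
  have h0 := hloc.hasDerivAt_eq_zero hd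
  unfold response
  rw [show lam - 1 - β * (Jhat * b) = Real.log a by linarith, Real.exp_log ha]

/-- The value of the minimum. -/
theorem minLocalFreeEnergy_eq {a b : ℝ} (ha : 0 ≤ a) (hb : 0 ≤ b)
    (hmin : IsMinOn (fun p : ℝ × ℝ => localFreeEnergy β Jhat lam p.1 p.2)
      (Ici 0 ×ˢ Ici 0) (a, b)) :
    minLocalFreeEnergy β Jhat lam = localFreeEnergy β Jhat lam a b := by
  unfold minLocalFreeEnergy
  apply IsLeast.csInf_eq
  refine ⟨⟨(a, b), ⟨ha, hb⟩, rfl⟩, ?_⟩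
  rintro _ ⟨p, hp, rfl⟩
  exact (isMinOn_iff.1 hmin) p hp

/-- The well energy is the value of `localFreeEnergy` at a particular second density, minus the
minimum. -/
theorem wellEnergy_nonneg {a b : ℝ} (ha : 0 ≤ a) (hb : 0 ≤ b)
    (hmin : IsMinOn (fun p : ℝ × ℝ => localFreeEnergy β Jhat lam p.1 p.2)
      (Ici 0 ×ˢ Ici 0) (a, b)) {m : ℝ} (hm : 0 ≤ m) : 0 ≤ wellEnergy β Jhat lam m := by
  have h := (isMinOn_iff.1 hmin) (m, response β lam (Jhat * m)) ⟨hm, (response_pos _ _ _).le⟩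
  simp only [localFreeEnergy_response, ← minLocalFreeEnergy_eq ha hb hmin] at h
  unfold wellEnergy; linarith

theorem hasDerivAt_wellEnergy {m : ℝ} (hm : 0 < m) :
    HasDerivAt (wellEnergy β Jhat lam)
      (Real.log m + 1 - lam + β * Jhat * response β lam (Jhat * m)) m := by
  unfold wellEnergy
  have h1 := Real.hasDerivAt_mul_log hm.ne'
  have h2 := (hasDerivAt_id m).const_mul lam
  have h3 := (hasDerivAt_response β lam (Jhat * m)).comp m ((hasDerivAt_id m).const_mul Jhat)
  refine (((h1.sub h2).sub h3).sub_const (minLocalFreeEnergy β Jhat lam)).congr_deriv ?_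
  ring

theorem hasDerivAt_wellEnergy_deriv {m : ℝ} (hm : 0 < m) :
    HasDerivAt (fun m => Real.log m + 1 - lam + β * Jhat * response β lam (Jhat * m))
      (m⁻¹ - (β * Jhat) ^ 2 * response β lam (Jhat * m)) m := by
  have h1 := Real.hasDerivAt_log hm.ne'
  have h3 := (hasDerivAt_response β lam (Jhat * m)).comp m ((hasDerivAt_id m).const_mul Jhat)
  refine (((h1.add_const 1).sub_const lam).add (h3.const_mul (β * Jhat))).congr_deriv ?_
  ring

/-- Between two zeros of the derivative of the well energy there is an inflection point. -/
theorem exists_inflection {x y : ℝ} (hb : 0 < β * Jhat) (hx : 0 < x) (hxy : x < y)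
    (h0x : Real.log x + 1 - lam + β * Jhat * response β lam (Jhat * x) = 0)
    (h0y : Real.log y + 1 - lam + β * Jhat * response β lam (Jhat * y) = 0) :
    ∃ z ∈ Ioo x y, Real.log z = β * Jhat * z - (lam - 1) - 2 * Real.log (β * Jhat) := by
  obtain ⟨z, hz, h⟩ := exists_hasDerivAt_eq_zero
    (f := fun m => Real.log m + 1 - lam + β * Jhat * response β lam (Jhat * m)) hxy
    (fun m hm => (hasDerivAt_wellEnergy_deriv (hx.trans_le hm.1)).continuousAt.continuousWithinAt)
    (h0x.trans h0y.symm) (fun m hm => hasDerivAt_wellEnergy_deriv (hx.trans hm.1))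
  refine ⟨z, hz, ?_⟩
  have hz0 : 0 < z := hx.trans hz.1
  have h2 : z⁻¹ = (β * Jhat) ^ 2 * response β lam (Jhat * z) := by linarith
  -- Logarithms turn the vanishing of the second derivative into the intersection of `log` with a
  -- line.
  have h3 := congrArg Real.log h2
  rw [Real.log_inv, Real.log_mul (by positivity) (response_pos _ _ _).ne', log_response,
    Real.log_pow] at h3
  push_cast at h3
  linarith

/-- Between two zeros of the well energy there is a critical point. -/
theorem exists_critical {x y : ℝ} (hx : 0 < x) (hxy : x < y)
    (h0x : wellEnergy β Jhat lam x = 0) (h0y : wellEnergy β Jhat lam y = 0) :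
    ∃ z ∈ Ioo x y, Real.log z + 1 - lam + β * Jhat * response β lam (Jhat * z) = 0 :=
  exists_hasDerivAt_eq_zero hxy
    (fun _ hm => (hasDerivAt_wellEnergy (hx.trans_le hm.1)).continuousAt.continuousWithinAt)
    (h0x.trans h0y.symm) (fun _ hm => hasDerivAt_wellEnergy (hx.trans hm.1))

/-- By strict concavity of the logarithm. -/
theorem log_slope_lt {x y z c d : ℝ} (hx : 0 < x) (hxy : x < y) (hyz : y < z)
    (hy0 : Real.log y = c * y + d) (hz0 : Real.log z = c * z + d) : Real.log x < c * x + d := by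
  have h := strictConcaveOn_log_Ioi.slope_anti_adjacent (x := x) (y := y) (z := z) hx
    (hx.trans (hxy.trans hyz)) hxy hyz
  rw [div_lt_div_iff₀ (by linarith) (by linarith), hy0, hz0] at h
  have h2 : (z - y) * (c * (y - x)) < (z - y) * (c * y + d - Real.log x) := by nlinarith
  have := lt_of_mul_lt_mul_left h2 (by linarith)
  linarith

end Constants

/-- The two-phase regime of the statement provides all the constants that are needed. -/
theorem TwoPhase.of_isMinOn {J : ℝ → ℝ} {L β lam ρm ρp : ℝ} (hJ : IsKernel J L) (hβ : 0 < β)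
    (hρm : 0 ≤ ρm) (hρ : ρm < ρp)
    (hmin : IsMinOn (fun p : ℝ × ℝ => localFreeEnergy β (∫ s, J s) lam p.1 p.2)
      (Ici 0 ×ˢ Ici 0) (ρm, ρp)) : TwoPhase J L β lam ρm ρp := by
  have hp : 0 < ρp := hρm.trans_lt hρ
  have hmin' : IsMinOn (fun p : ℝ × ℝ => localFreeEnergy β (∫ s, J s) lam p.1 p.2)
      (Ici 0 ×ˢ Ici 0) (ρp, ρm) := by
    rw [isMinOn_iff] at hmin ⊢
    intro q hq
    have := hmin (q.2, q.1) ⟨hq.2, hq.1⟩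
    rw [localFreeEnergy_comm, localFreeEnergy_comm β _ lam q.1]
    exact this
  have hm : 0 < ρm := pos_of_isMinOn hρm hp.le hmin
  have e1 := eq_response_of_isMinOn hm hp.le hmin
  have e2 := eq_response_of_isMinOn hp hρm hmin'
  have hg := minLocalFreeEnergy_eq hρm hp.le hmin
  have hJ0 : 0 < ∫ s, J s := by
    rcases (integral_nonneg hJ.nonneg : 0 ≤ ∫ s, J s).lt_or_eq with h | h
    · exact h
    · exfalso
      rw [← h, zero_mul] at e1 e2
      rw [← e2] at e1
      exact hρ.ne e1
  set b := ∫ s, J s with hbdef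
  have hb : 0 < β * b := mul_pos hβ hJ0
  have l1 : Real.log ρm = lam - 1 - β * (b * ρp) := by
    conv_lhs => rw [e1]
    exact log_response _ _ _
  have l2 : Real.log ρp = lam - 1 - β * (b * ρm) := by
    conv_lhs => rw [e2]
    exact log_response _ _ _
  have d1 : Real.log ρm + 1 - lam + β * b * response β lam (b * ρm) = 0 := by
    rw [← e2, l1]; ring
  have d2 : Real.log ρp + 1 - lam + β * b * response β lam (b * ρp) = 0 := by
    rw [← e1, l2]; ring
  have w1 : wellEnergy β b lam ρm = 0 := by
    have := localFreeEnergy_response β b lam ρm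
    unfold wellEnergy
    rw [hg, ← this, ← e2, sub_self]
  have w2 : wellEnergy β b lam ρp = 0 := by
    have := localFreeEnergy_response β b lam ρp
    unfold wellEnergy
    rw [hg, ← this, ← e1, localFreeEnergy_comm, sub_self]
  refine ⟨hJ, hβ, hJ0, hm, hρ, e1.symm, e2.symm, ?_, ?_, ?_⟩
  -- The critical points `ρm < y < ρp` enclose two inflection points. Left of both, `log` is below
  -- the line; at `ρm`, after inserting `log ρp = lam - 1 - β Ĵ ρm`, this is the stability
  -- inequality.
  · obtain ⟨y, hy, hy0⟩ := exists_critical hm hρ w1 w2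
    obtain ⟨z1, hz1, h1⟩ := exists_inflection hb hm hy.1 d1 hy0
    obtain ⟨z2, hz2, h2⟩ := exists_inflection hb (hm.trans hy.1) hy.2 hy0 d2
    have key := log_slope_lt (c := β * b) (d := - (lam - 1) - 2 * Real.log (β * b)) hm hz1.1
      (hz1.2.trans hz2.1) (by linarith) (by linarith)
    have : Real.log ((β * b) ^ 2 * ρm * ρp) < 0 := by
      rw [Real.log_mul (by positivity) hp.ne', Real.log_mul (by positivity) hm.ne', Real.log_pow]
      push_cast
      linarith
    exact (Real.log_neg_iff (by positivity)).1 this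
  · intro x hx
    have hx0 : 0 < x := hm.trans hx.1
    rcases (wellEnergy_nonneg hρm hp.le hmin hx0.le).lt_or_eq with h | h
    · exact h
    · exfalso
      -- A further zero would be a minimum, hence critical. Rolle's theorem would then yield three
      -- points of `log` on one line.
      have hloc : IsLocalMin (wellEnergy β b lam) x := by
        filter_upwards [lt_mem_nhds hx0] with m hm
        rw [← h]
        exact wellEnergy_nonneg hρm hp.le hmin hm.le
      have dx := hloc.hasDerivAt_eq_zero (hasDerivAt_wellEnergy hx0)
      obtain ⟨y, hy, hy0⟩ := exists_critical hm hx.1 w1 h.symm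
      obtain ⟨y', hy', hy0'⟩ := exists_critical hx0 hx.2 h.symm w2
      obtain ⟨z1, hz1, h1⟩ := exists_inflection hb hm hy.1 d1 hy0
      obtain ⟨z2, hz2, h2⟩ := exists_inflection hb (hm.trans hy.1) hy.2 hy0 dx
      obtain ⟨z3, hz3, h3⟩ := exists_inflection hb hx0 hy'.1 dx hy0'
      have key := log_slope_lt (c := β * b) (d := - (lam - 1) - 2 * Real.log (β * b))
        (hm.trans hz1.1) (hz1.2.trans hz2.1) (hz2.2.trans hz3.1) (by linarith) (by linarith)
      linarith
  · rw [hg]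
    unfold localFreeEnergy
    rw [l1, l2]; ring

/-! ### Potentials: algebra, limits and the quadratic form -/

/-- The potential `J * u` exerted by the density `u`. -/
def conv (J u : ℝ → ℝ) (x : ℝ) : ℝ := ∫ s, J s * u (x - s)

section Conv

variable {J u w : ℝ → ℝ} {C C' : ℝ}

theorem integral_kernel_mul (J n : ℝ → ℝ) (m x : ℝ) :
    ∫ y, J (x - y) * m * n y = m * conv J n x := by
  unfold conv
  rw [← integral_sub_left_eq_self (fun s => J s * n (x - s)) volume x, ← integral_const_mul]
  congr 1
  ext y
  rw [sub_sub_cancel]; ring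

theorem integrable_conv_integrand (hJ : Integrable J) (hu : Measurable u) (hb : ∀ x, |u x| ≤ C)
    (x : ℝ) : Integrable (fun s => J s * u (x - s)) := by
  refine hJ.mul_bdd (c := C) ?_ (ae_of_all _ fun s => by simpa using hb (x - s))
  exact (hu.comp (measurable_const.sub measurable_id)).aestronglyMeasurable

theorem conv_const (J : ℝ → ℝ) (c x : ℝ) : conv J (fun _ => c) x = (∫ s, J s) * c := by
  unfold conv; rw [integral_mul_const]

theorem conv_sub (hJ : Integrable J) (hu : Measurable u) (hb : ∀ x, |u x| ≤ C)
    (hw : Measurable w) (hb' : ∀ x, |w x| ≤ C') (x : ℝ) :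
    conv J (fun y => u y - w y) x = conv J u x - conv J w x := by
  unfold conv
  rw [← integral_sub (integrable_conv_integrand hJ hu hb x) (integrable_conv_integrand hJ hw hb' x)]
  congr 1; ext s; ring

theorem conv_add (hJ : Integrable J) (hu : Measurable u) (hb : ∀ x, |u x| ≤ C)
    (hw : Measurable w) (hb' : ∀ x, |w x| ≤ C') (x : ℝ) :
    conv J (fun y => u y + w y) x = conv J u x + conv J w x := by
  unfold conv
  rw [← integral_add (integrable_conv_integrand hJ hu hb x) (integrable_conv_integrand hJ hw hb' x)]
  congr 1; ext s; ring

theorem conv_const_mul (J u : ℝ → ℝ) (c x : ℝ) :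
    conv J (fun y => c * u y) x = c * conv J u x := by
  unfold conv
  rw [← integral_const_mul]
  congr 1; ext s; ring

theorem conv_comp_add (J u : ℝ → ℝ) (a x : ℝ) :
    conv J (fun y => u (y + a)) x = conv J u (x + a) := by
  unfold conv
  congr 1; ext s
  show J s * u (x - s + a) = J s * u (x + a - s)
  rw [sub_add_eq_add_sub]

theorem conv_comp_neg (hJ : ∀ x, J (-x) = J x) (u : ℝ → ℝ) (x : ℝ) :
    conv J (fun y => u (-y)) x = conv J u (-x) := by
  unfold conv
  rw [← integral_neg_eq_self (fun s => J s * u (-x - s))]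
  congr 1; ext s
  show J s * u (-(x - s)) = J (-s) * u (-x - -s)
  rw [hJ, show -x - -s = -(x - s) by ring]

theorem conv_congr_ae (h : u =ᵐ[volume] w) (x : ℝ) : conv J u x = conv J w x := by
  unfold conv
  refine integral_congr_ae ?_
  have := (Measure.measurePreserving_sub_left volume x).quasiMeasurePreserving.ae_eq_comp h
  filter_upwards [this] with s hs
  simp only [Function.comp] at hs
  rw [hs]

/-- Dominated convergence for potentials. -/
theorem tendsto_conv {ι : Type*} {l : Filter ι} [l.IsCountablyGenerated] {F : ι → ℝ → ℝ}
    {y : ι → ℝ} {G : ℝ → ℝ} (hJ : Integrable J) (hF : ∀ i, Measurable (F i))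
    (hb : ∀ i x, |F i x| ≤ C)
    (h : ∀ᵐ s, Tendsto (fun i => F i (y i - s)) l (𝓝 (G s))) :
    Tendsto (fun i => conv J (F i) (y i)) l (𝓝 (∫ s, J s * G s)) := by
  unfold conv
  refine tendsto_integral_filter_of_dominated_convergence (fun s => C * |J s|) ?_ ?_ ?_ ?_
  · exact Eventually.of_forall fun i =>
      (integrable_conv_integrand hJ (hF i) (hb i) (y i)).aestronglyMeasurable
  · refine Eventually.of_forall fun i => ae_of_all _ fun s => ?_
    rw [Real.norm_eq_abs, abs_mul, mul_comm]
    exact mul_le_mul_of_nonneg_right (hb i _) (abs_nonneg _)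
  · exact hJ.abs.const_mul C
  · filter_upwards [h] with s hs using hs.const_mul _

theorem continuous_conv (hJ : Integrable J) (hu : Measurable u) (hb : ∀ x, |u x| ≤ C)
    (hc : {x | ¬ ContinuousAt u x}.Countable) : Continuous (conv J u) := by
  rw [continuous_iff_continuousAt]
  intro x
  refine tendsto_conv (F := fun _ => u) (y := fun x => x) hJ (fun _ => hu) (fun _ => hb) ?_
  have h1 : {s | ¬ ContinuousAt u (x - s)}.Countable :=
    hc.preimage (f := fun s => x - s) sub_right_injective
  filter_upwards [h1.ae_notMem volume] with s hs
  have h2 : ContinuousAt u (x - s) := not_not.1 hs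
  exact h2.tendsto.comp (tendsto_id.sub_const s)

theorem tendsto_conv_atTop (hJ : Integrable J) (hu : Measurable u) (hb : ∀ x, |u x| ≤ C) {c : ℝ}
    (h : Tendsto u atTop (𝓝 c)) : Tendsto (conv J u) atTop (𝓝 ((∫ s, J s) * c)) := by
  rw [← integral_mul_const]
  refine tendsto_conv (F := fun _ => u) (y := fun x => x) hJ (fun _ => hu) (fun _ => hb) ?_
  exact ae_of_all _ fun s => h.comp (tendsto_atTop_add_const_right _ (-s) tendsto_id)

theorem tendsto_conv_atBot (hJ : Integrable J) (hu : Measurable u) (hb : ∀ x, |u x| ≤ C) {c : ℝ}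
    (h : Tendsto u atBot (𝓝 c)) : Tendsto (conv J u) atBot (𝓝 ((∫ s, J s) * c)) := by
  rw [← integral_mul_const]
  refine tendsto_conv (F := fun _ => u) (y := fun x => x) hJ (fun _ => hu) (fun _ => hb) ?_
  exact ae_of_all _ fun s => h.comp (tendsto_atBot_add_const_right _ (-s) tendsto_id)

/-- The quadratic form of the interaction is absolutely convergent and symmetric. -/
theorem integrable_mul_conv_and_symm (hJ : Integrable J) (heven : ∀ x, J (-x) = J x)
    (hu : Measurable u) (hb : ∀ x, |u x| ≤ C) (hw : Integrable w) :
    Integrable (fun x => w x * conv J u x) ∧ Integrable (fun x => u x * conv J w x) ∧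
      ∫ x, u x * conv J w x = ∫ x, w x * conv J u x := by
  have hint : Integrable (fun p : ℝ × ℝ => w p.2 * J (p.1 - p.2)) (volume.prod volume) := by
    have := hw.convolution_integrand (ContinuousLinearMap.mul ℝ ℝ) hJ
    simpa using this
  have hint2 : Integrable (fun p : ℝ × ℝ => u p.1 * (w p.2 * J (p.1 - p.2)))
      (volume.prod volume) := by
    refine hint.bdd_mul (c := C) ?_ (ae_of_all _ fun p => by simpa using hb p.1)
    exact (hu.comp measurable_fst).aestronglyMeasurable
  have e1 : ∀ x, ∫ y, u x * (w y * J (x - y)) = u x * conv J w x := by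
    intro x
    rw [← integral_kernel_mul]
    congr 1; ext y; ring
  have e2 : ∀ y, ∫ x, u x * (w y * J (x - y)) = w y * conv J u y := by
    intro y
    rw [← integral_kernel_mul]
    congr 1; ext x
    rw [← heven (x - y), neg_sub]; ring
  refine ⟨?_, ?_, ?_⟩
  · have := hint2.integral_prod_right
    simpa only [e2] using this
  · have := hint2.integral_prod_left
    simpa only [e1] using this
  · have := integral_integral_swap (f := fun x y => u x * (w y * J (x - y))) hint2
    simpa only [e1, e2] using this

end Conv

/-! ### Order properties of potentials -/

section Kernel

variable {J u w : ℝ → ℝ} {L C C' : ℝ}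

theorem IsKernel.conv_mono (hJ : IsKernel J L) (hu : Measurable u) (hb : ∀ x, |u x| ≤ C)
    (hw : Measurable w) (hb' : ∀ x, |w x| ≤ C') {x : ℝ}
    (h : ∀ y, x - L ≤ y → y ≤ x + L → u y ≤ w y) : conv J u x ≤ conv J w x := by
  refine integral_mono (integrable_conv_integrand hJ.integrable hu hb x)
    (integrable_conv_integrand hJ.integrable hw hb' x) fun s => ?_
  by_cases hs : |s| ≤ L
  · have := abs_le.1 hs
    exact mul_le_mul_of_nonneg_left (h _ (by linarith) (by linarith)) (hJ.nonneg s)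
  · simp [hJ.supp s (not_le.1 hs)]

theorem IsKernel.conv_le (hJ : IsKernel J L) (hu : Measurable u) (hb : ∀ x, |u x| ≤ C)
    {x c : ℝ} (h : ∀ y, x - L ≤ y → y ≤ x + L → u y ≤ c) : conv J u x ≤ (∫ s, J s) * c := by
  rw [← conv_const J c x]
  exact hJ.conv_mono hu hb measurable_const (fun _ => le_rfl) h

theorem IsKernel.le_conv (hJ : IsKernel J L) (hu : Measurable u) (hb : ∀ x, |u x| ≤ C)
    {x c : ℝ} (h : ∀ y, x - L ≤ y → y ≤ x + L → c ≤ u y) : (∫ s, J s) * c ≤ conv J u x := by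
  rw [← conv_const J c x]
  exact hJ.conv_mono measurable_const (fun _ => le_rfl) hu hb h

theorem IsKernel.conv_monotone (hJ : IsKernel J L) (hu : Monotone u) (hb : ∀ x, |u x| ≤ C) :
    Monotone (conv J u) := by
  intro x y hxy
  refine integral_mono (integrable_conv_integrand hJ.integrable hu.measurable hb x)
    (integrable_conv_integrand hJ.integrable hu.measurable hb y) fun s => ?_
  exact mul_le_mul_of_nonneg_left (hu (by linarith)) (hJ.nonneg s)

theorem IsKernel.conv_antitone (hJ : IsKernel J L) (hu : Antitone u) (hb : ∀ x, |u x| ≤ C) :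
    Antitone (conv J u) := by
  intro x y hxy
  refine integral_mono (integrable_conv_integrand hJ.integrable hu.measurable hb y)
    (integrable_conv_integrand hJ.integrable hu.measurable hb x) fun s => ?_
  exact mul_le_mul_of_nonneg_left (hu (by linarith)) (hJ.nonneg s)

/-- A kernel of positive mass is positive in a punctured neighbourhood of the origin. -/
theorem IsKernel.exists_pos (hJ : IsKernel J L) (h : 0 < ∫ s, J s) :
    ∃ r > 0, ∀ s, s ≠ 0 → |s| < r → 0 < J s := by
  obtain ⟨t, ht0, ht⟩ : ∃ t, 0 < t ∧ 0 < J t := by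
    by_contra! hcon
    have hz : ∀ s, s ≠ 0 → J s = 0 := by
      intro s hs
      rcases hs.lt_or_gt with h | h
      · rw [← hJ.even]
        exact le_antisymm (hcon _ (by linarith)) (hJ.nonneg _)
      · exact le_antisymm (hcon _ h) (hJ.nonneg _)
    have : ∫ s, J s = 0 := by
      refine integral_eq_zero_of_ae ?_
      filter_upwards [Measure.ae_ne volume 0] with s hs using hz s hs
    exact h.ne' this
  -- Evenness and monotonicity bound `J` below by `J t > 0` for `0 < |s| < t`; the value at the
  -- origin is unconstrained.
  refine ⟨t, ht0, fun s hs hst => ?_⟩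
  have h2 : J s = J |s| := by
    rcases abs_choice s with h | h <;> rw [h]
    exact (hJ.even s).symm
  rw [h2]
  exact ht.trans_le (hJ.anti (abs_pos.2 hs) ht0 hst.le)

/-- Strong maximum principle for potentials. -/
theorem IsKernel.eq_zero_of_conv_eq_zero (hJ : IsKernel J L) {r : ℝ}
    (hr : ∀ s, s ≠ 0 → |s| < r → 0 < J s) (hw : Continuous w) (hb : ∀ x, |w x| ≤ C)
    (h0 : ∀ x, 0 ≤ w x) {x : ℝ} (h : conv J w x = 0) {y : ℝ} (hy : |x - y| < r) : w y = 0 := by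
  have h1 := (integral_eq_zero_iff_of_nonneg (fun s => mul_nonneg (hJ.nonneg s) (h0 (x - s)))
    (integrable_conv_integrand hJ.integrable hw.measurable hb x)).1 h
  by_contra hne
  have hpos : 0 < w y := lt_of_le_of_ne (h0 y) (Ne.symm hne)
  -- If `w y > 0`, the integrand is positive on this nonempty open set minus the origin, a set of
  -- positive measure, although it vanishes almost everywhere.
  have hopen : IsOpen {s : ℝ | 0 < w (x - s) ∧ |s| < r} :=
    (isOpen_lt continuous_const (hw.comp (continuous_const.sub continuous_id))).inter
      (isOpen_lt continuous_abs continuous_const)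
  have hmem : (x - y) ∈ {s : ℝ | 0 < w (x - s) ∧ |s| < r} := ⟨by simpa using hpos, hy⟩
  have hmeas := hopen.measure_pos volume ⟨_, hmem⟩
  have hnull : volume {s : ℝ | 0 < w (x - s) ∧ |s| < r} = 0 := by
    refine measure_mono_null ?_ (ae_iff.1 (h1.and (Measure.ae_ne volume 0)))
    rintro s ⟨hs1, hs2⟩ ⟨hs3, hs4⟩
    exact (mul_pos (hr s hs4 hs2) hs1).ne' hs3
  exact hmeas.ne' hnull

end Kernel

/-! ### Fronts: comparison, uniqueness and strict monotonicity -/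

/-- Fronts: monotone solutions of the Euler–Lagrange system which connect the two phases. -/
structure IsFront (J : ℝ → ℝ) (β lam ρm ρp : ℝ) (u v : ℝ → ℝ) : Prop where
  mono : Monotone u
  anti : Antitone v
  u_bot : Tendsto u atBot (𝓝 ρm)
  u_top : Tendsto u atTop (𝓝 ρp)
  v_bot : Tendsto v atBot (𝓝 ρp)
  v_top : Tendsto v atTop (𝓝 ρm)
  u_eq : ∀ x, u x = response β lam (conv J v x)
  v_eq : ∀ x, v x = response β lam (conv J u x)

section Fronts

variable {J : ℝ → ℝ} {L β lam ρm ρp : ℝ} {u v u' v' : ℝ → ℝ}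

theorem TwoPhase.high_pos (H : TwoPhase J L β lam ρm ρp) : 0 < ρp := H.low_pos.trans H.low_lt_high

theorem TwoPhase.abs_le (H : TwoPhase J L β lam ρm ρp) {t : ℝ} (h1 : ρm ≤ t) (h2 : t ≤ ρp) :
    |t| ≤ ρp := by
  rwa [abs_of_nonneg (H.low_pos.le.trans h1)]

/-- The linearization at the pure phases is a contraction, with some room. -/
theorem TwoPhase.exists_room (H : TwoPhase J L β lam ρm ρp) :
    ∃ δ > 0, (β * ∫ s, J s) ^ 2 * ρp * (ρm + δ) < 1 := by
  have hb : 0 < (β * ∫ s, J s) ^ 2 * ρp :=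
    mul_pos (pow_pos (mul_pos H.β_pos H.mass_pos) 2) H.high_pos
  have h1 := H.stable
  -- This `δ` places the product halfway between `(β Ĵ)² ρm ρp` and `1`.
  refine ⟨(1 - (β * ∫ s, J s) ^ 2 * ρm * ρp) / (2 * ((β * ∫ s, J s) ^ 2 * ρp)), ?_, ?_⟩
  · exact div_pos (by linarith) (by linarith)
  · rw [mul_add, mul_div_assoc', mul_comm 2, mul_div_mul_left _ _ hb.ne']
    nlinarith

theorem IsFront.low_le_u (h : IsFront J β lam ρm ρp u v) (x : ℝ) : ρm ≤ u x :=
  h.mono.le_of_tendsto h.u_bot x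

theorem IsFront.u_le_high (h : IsFront J β lam ρm ρp u v) (x : ℝ) : u x ≤ ρp :=
  h.mono.ge_of_tendsto h.u_top x

theorem IsFront.low_le_v (h : IsFront J β lam ρm ρp u v) (x : ℝ) : ρm ≤ v x :=
  h.anti.le_of_tendsto h.v_top x

theorem IsFront.v_le_high (h : IsFront J β lam ρm ρp u v) (x : ℝ) : v x ≤ ρp :=
  h.anti.ge_of_tendsto h.v_bot x

theorem IsFront.abs_u_le (h : IsFront J β lam ρm ρp u v) (H : TwoPhase J L β lam ρm ρp) (x : ℝ) :
    |u x| ≤ ρp := H.abs_le (h.low_le_u x) (h.u_le_high x)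

theorem IsFront.abs_v_le (h : IsFront J β lam ρm ρp u v) (H : TwoPhase J L β lam ρm ρp) (x : ℝ) :
    |v x| ≤ ρp := H.abs_le (h.low_le_v x) (h.v_le_high x)

theorem IsFront.shift (h : IsFront J β lam ρm ρp u v) (a : ℝ) :
    IsFront J β lam ρm ρp (fun x => u (x + a)) (fun x => v (x + a)) where
  mono _ _ hxy := h.mono (by linarith)
  anti _ _ hxy := h.anti (by linarith)
  u_bot := h.u_bot.comp (tendsto_atBot_add_const_right _ a tendsto_id)
  u_top := h.u_top.comp (tendsto_atTop_add_const_right _ a tendsto_id)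
  v_bot := h.v_bot.comp (tendsto_atBot_add_const_right _ a tendsto_id)
  v_top := h.v_top.comp (tendsto_atTop_add_const_right _ a tendsto_id)
  u_eq x := by rw [conv_comp_add]; exact h.u_eq _
  v_eq x := by rw [conv_comp_add]; exact h.v_eq _

/-- Reflecting space and exchanging the species maps fronts to fronts. -/
theorem IsFront.reflect (h : IsFront J β lam ρm ρp u v) (hJ : ∀ x, J (-x) = J x) :
    IsFront J β lam ρm ρp (fun x => v (-x)) (fun x => u (-x)) where
  mono _ _ hxy := h.anti (by linarith)
  anti _ _ hxy := h.mono (by linarith)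
  u_bot := h.v_top.comp tendsto_neg_atBot_atTop
  u_top := h.v_bot.comp tendsto_neg_atTop_atBot
  v_bot := h.u_top.comp tendsto_neg_atBot_atTop
  v_top := h.u_bot.comp tendsto_neg_atTop_atBot
  u_eq x := by rw [conv_comp_neg hJ]; exact h.v_eq _
  v_eq x := by rw [conv_comp_neg hJ]; exact h.u_eq _

theorem IsFront.continuous_u (h : IsFront J β lam ρm ρp u v) (H : TwoPhase J L β lam ρm ρp) :
    Continuous u := by
  rw [funext h.u_eq]
  exact (continuous_response β lam).comp (continuous_conv H.integrable h.anti.measurable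
    (h.abs_v_le H) h.anti.countable_not_continuousAt)

theorem IsFront.continuous_v (h : IsFront J β lam ρm ρp u v) (H : TwoPhase J L β lam ρm ρp) :
    Continuous v := by
  rw [funext h.v_eq]
  exact (continuous_response β lam).comp (continuous_conv H.integrable h.mono.measurable
    (h.abs_u_le H) h.mono.countable_not_continuousAt)

/-- Outside the transition region the system contracts the negative part of `u - u'`. -/
theorem IsFront.comparison_step (H : TwoPhase J L β lam ρm ρp) (h : IsFront J β lam ρm ρp u v)
    (h' : IsFront J β lam ρm ρp u' v') {A B δ M : ℝ} (hA : u' A ≤ ρm + δ) (hB : v B ≤ ρm + δ)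
    (hAB : ∀ x ∈ Icc A (B + L), u' x ≤ u x) (hM : 0 ≤ M) (hle : ∀ x, u' x ≤ u x + M) (x : ℝ) :
    u' x ≤ u x + (β * ∫ s, J s) ^ 2 * ρp * (ρm + δ) * M := by
  have hJ := H.toIsKernel
  set b := ∫ s, J s with hbdef
  have hb : 0 < b := H.mass_pos
  have hβ := H.β_pos
  have hp := H.high_pos
  have hδ : 0 < ρm + δ := H.low_pos.trans_le ((h'.low_le_u A).trans hA)
  -- The tangent inequality keeps the factor `v y`, which is close to `ρm` on the right; `key2`
  -- likewise keeps `u' x`, close to `ρm` on the left.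
  have key1 : ∀ y, v y - v' y ≤ v y * (β * (b * M)) := by
    intro y
    have h1 : conv J u' y ≤ conv J u y + b * M := by
      rw [← conv_const J M y, ← conv_add hJ.integrable h.mono.measurable (h.abs_u_le H)
        measurable_const (fun _ => le_rfl)]
      refine hJ.conv_mono (C' := ρp + M) h'.mono.measurable (h'.abs_u_le H)
        (h.mono.measurable.add_const M) (fun z => ?_) (fun z _ _ => hle z)
      have := h.low_le_u z
      have := h.u_le_high z
      have := H.low_pos
      rw [abs_of_nonneg (by linarith)]; linarith
    rw [h.v_eq y, h'.v_eq y]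
    refine (response_sub_le _ _ _ _).trans ?_
    have := (response_pos β lam (conv J u y)).le
    gcongr
    linarith
  have key2 : ∀ c, (∀ y, x - L ≤ y → y ≤ x + L → v y ≤ v' y + c) →
      u' x - u x ≤ u' x * (β * (b * c)) := by
    intro c hc
    have h1 : conv J v x ≤ conv J v' x + b * c := by
      rw [← conv_const J c x, ← conv_add hJ.integrable h'.anti.measurable (h'.abs_v_le H)
        measurable_const (fun _ => le_rfl)]
      refine hJ.conv_mono (C' := ρp + |c|) h.anti.measurable (h.abs_v_le H)
        (h'.anti.measurable.add_const c) (fun z => ?_) hc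
      exact (abs_add_le _ _).trans (add_le_add (h'.abs_v_le H z) le_rfl)
    rw [h.u_eq x, h'.u_eq x]
    refine (response_sub_le _ _ _ _).trans ?_
    have := (response_pos β lam (conv J v' x)).le
    gcongr
    linarith
  have hu'0 : 0 ≤ u' x := H.low_pos.le.trans (h'.low_le_u x)
  have hθ : 0 ≤ (β * b) ^ 2 * ρp * (ρm + δ) * M := by positivity
  -- On either side one of the two factors is at most `ρm + δ` and the other at most `ρp`. On the
  -- right, `x > B + L` ensures that `v` is small on the whole interaction range of `x`.
  rcases lt_or_ge x A with hx | hx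
  · have h1 := key2 (ρp * (β * (b * M))) fun y _ _ => by
      have h2 := mul_le_mul_of_nonneg_right (h.v_le_high y) (by positivity : 0 ≤ β * (b * M))
      linarith [key1 y]
    have h2 : u' x ≤ ρm + δ := (h'.mono hx.le).trans hA
    have h3 := mul_le_mul_of_nonneg_right h2
      (by positivity : 0 ≤ β * (b * (ρp * (β * (b * M)))))
    nlinarith
  · rcases le_or_gt x (B + L) with hx2 | hx2
    · linarith [hAB x ⟨hx, hx2⟩]
    · have h1 := key2 ((ρm + δ) * (β * (b * M))) fun y hy _ => by
        have h0 : v y ≤ ρm + δ := (h.anti (by linarith : B ≤ y)).trans hB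
        have h2 := mul_le_mul_of_nonneg_right h0 (by positivity : 0 ≤ β * (b * M))
        linarith [key1 y]
      have h3 := mul_le_mul_of_nonneg_right (h'.u_le_high x)
        (by positivity : 0 ≤ β * (b * ((ρm + δ) * (β * (b * M)))))
      nlinarith

/-- Fronts which are ordered in the transition region are ordered. -/
theorem IsFront.comparison (H : TwoPhase J L β lam ρm ρp) (h : IsFront J β lam ρm ρp u v)
    (h' : IsFront J β lam ρm ρp u' v') {A B δ : ℝ}
    (hδ : (β * ∫ s, J s) ^ 2 * ρp * (ρm + δ) < 1) (hA : u' A ≤ ρm + δ) (hB : v B ≤ ρm + δ)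
    (hAB : ∀ x ∈ Icc A (B + L), u' x ≤ u x) (x : ℝ) : u' x ≤ u x := by
  set θ := (β * ∫ s, J s) ^ 2 * ρp * (ρm + δ) with hθ
  have hθ0 : 0 ≤ θ := by
    have := H.high_pos
    have : 0 < ρm + δ := H.low_pos.trans_le ((h'.low_le_u A).trans hA)
    positivity
  have hρ := H.low_lt_high
  -- The violation of order is at most `ρp - ρm` initially, and each comparison step multiplies the
  -- bound by `θ < 1`.
  have hk : ∀ k : ℕ, ∀ x, u' x ≤ u x + θ ^ k * (ρp - ρm) := by
    intro k
    induction k with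
    | zero => intro x; linarith [h.low_le_u x, h'.u_le_high x]
    | succ k ih =>
      intro x
      have := h.comparison_step H h' hA hB hAB
        (mul_nonneg (pow_nonneg hθ0 k) (by linarith)) ih x
      rw [pow_succ]
      nlinarith
  have hlim : Tendsto (fun k : ℕ => u x + θ ^ k * (ρp - ρm)) atTop (𝓝 (u x)) := by
    simpa using ((tendsto_pow_atTop_nhds_zero_of_lt_one hθ0 hδ).mul_const (ρp - ρm)).const_add (u x)
  exact ge_of_tendsto' hlim fun k => hk k x

/-- Ordered fronts which touch coincide. -/
theorem IsFront.eq_of_touch (H : TwoPhase J L β lam ρm ρp) (h : IsFront J β lam ρm ρp u v)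
    (h' : IsFront J β lam ρm ρp u' v') (hle : ∀ x, u' x ≤ u x) {x₀ : ℝ} (h0 : u' x₀ = u x₀)
    (x : ℝ) : u' x = u x := by
  have hJ := H.toIsKernel
  obtain ⟨r, hr, hrJ⟩ := hJ.exists_pos H.mass_pos
  have hbd : ∀ {s t : ℝ}, ρm ≤ s → s ≤ ρp → ρm ≤ t → t ≤ ρp → |s - t| ≤ ρp - ρm :=
    fun h1 h2 h3 h4 => abs_sub_le_iff.2 ⟨by linarith, by linarith⟩
  have hvle : ∀ y, v y ≤ v' y := by
    intro y
    rw [h.v_eq, h'.v_eq]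
    exact response_antitone H.β_pos.le lam (hJ.conv_mono h'.mono.measurable (h'.abs_u_le H)
      h.mono.measurable (h.abs_u_le H) fun z _ _ => hle z)
  -- Contact of `u` and `u'` at `y` makes the potential of the nonnegative function `v' - v` vanish
  -- there, hence also `v' - v` within distance `r`; `hv` carries contact back to the first species.
  have hu : ∀ y, u' y = u y → ∀ z, |y - z| < r → v' z = v z := by
    intro y hy z hz
    rw [h.u_eq, h'.u_eq] at hy
    have h1 := response_injective H.β_pos lam hy
    have h2 : conv J (fun y => v' y - v y) y = 0 := by
      rw [conv_sub hJ.integrable h'.anti.measurable (h'.abs_v_le H) h.anti.measurable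
        (h.abs_v_le H), h1, sub_self]
    exact sub_eq_zero.1 (hJ.eq_zero_of_conv_eq_zero hrJ ((h'.continuous_v H).sub (h.continuous_v H))
      (fun x => hbd (h'.low_le_v x) (h'.v_le_high x) (h.low_le_v x) (h.v_le_high x))
      (fun x => sub_nonneg.2 (hvle x)) h2 hz)
  have hv : ∀ y, v' y = v y → u' y = u y := by
    intro y hy
    rw [h.v_eq, h'.v_eq] at hy
    have h1 := response_injective H.β_pos lam hy
    have h2 : conv J (fun y => u y - u' y) y = 0 := by
      rw [conv_sub hJ.integrable h.mono.measurable (h.abs_u_le H) h'.mono.measurable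
        (h'.abs_u_le H), h1, sub_self]
    exact (sub_eq_zero.1 (hJ.eq_zero_of_conv_eq_zero hrJ
      ((h.continuous_u H).sub (h'.continuous_u H))
      (fun x => hbd (h.low_le_u x) (h.u_le_high x) (h'.low_le_u x) (h'.u_le_high x))
      (fun x => sub_nonneg.2 (hle x)) h2 (by simpa using hr))).symm
  have hclopen : IsClopen {y | u' y = u y} := by
    refine ⟨isClosed_eq (h'.continuous_u H) (h.continuous_u H), ?_⟩
    rw [Metric.isOpen_iff]
    intro y hy
    refine ⟨r, hr, fun z hz => hv z (hu y hy z ?_)⟩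
    rwa [abs_sub_comm, ← Real.dist_eq]
  have := hclopen.eq_univ ⟨x₀, h0⟩
  exact (this ▸ mem_univ x : x ∈ {y | u' y = u y})

/-- Fronts are unique up to translation. -/
theorem IsFront.exists_shift (H : TwoPhase J L β lam ρm ρp) (h : IsFront J β lam ρm ρp u v)
    (h' : IsFront J β lam ρm ρp u' v') :
    ∃ a, ∀ x, u' x = u (x - a) ∧ v' x = v (x - a) := by
  obtain ⟨δ, hδ0, hδ⟩ := H.exists_room
  have huc := h.continuous_u H
  have hvc := h.continuous_v H
  obtain ⟨A, hA⟩ : ∃ A, u' A ≤ ρm + δ :=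
    ((h'.u_bot.eventually_lt_const (by linarith : ρm < ρm + δ)).exists).imp fun _ h => h.le
  set S : Set ℝ := {s | ∀ x, u' x ≤ u (x + s)} with hS
  have hne : S.Nonempty := by
    obtain ⟨B, hB⟩ := (h.v_top.eventually_lt_const (by linarith : ρm < ρm + δ)).exists
    -- After this shift the second species is already small at `A - L - 1`, so the interval on which
    -- order must be checked is empty.
    refine ⟨B - (A - L - 1), fun x => ?_⟩
    refine (h.shift (B - (A - L - 1))).comparison H h' (A := A) (B := A - L - 1) hδ hA ?_ ?_ x
    · simpa using hB.le
    · intro y hy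
      have := hy.1.trans hy.2
      linarith
  have hbdd : BddBelow S := by
    -- At a point where `u'` exceeds `ρm`, a very negative shift would push `u` below it.
    obtain ⟨x₀, hx₀⟩ := (h'.u_top.eventually_const_lt H.low_lt_high).exists
    obtain ⟨N, hN⟩ := eventually_atBot.1 (h.u_bot.eventually_lt_const hx₀)
    refine ⟨N - x₀, fun s hs => ?_⟩
    by_contra hcon
    have := hN (x₀ + s) (by linarith)
    linarith [hs x₀]
  have hclosed : IsClosed S := by
    rw [hS, ofPred_forall]
    exact isClosed_iInter fun x =>
      isClosed_le continuous_const (huc.comp (continuous_const.add continuous_id))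
  have hmem := hclosed.csInf_mem hne hbdd
  set σ := sInf S with hσ
  have hshift := h.shift σ
  by_cases htouch : ∃ x₀, u' x₀ = u (x₀ + σ)
  · obtain ⟨x₀, hx₀⟩ := htouch
    have heq := hshift.eq_of_touch H h' hmem hx₀
    refine ⟨-σ, fun x => ⟨by rw [sub_neg_eq_add]; exact heq x, ?_⟩⟩
    rw [sub_neg_eq_add, h'.v_eq, funext heq]
    exact (hshift.v_eq x).symm
  · exfalso
    push Not at htouch
    have hlt : ∀ x, u' x < u (x + σ) := fun x => lt_of_le_of_ne (hmem x) (htouch x)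
    obtain ⟨B, hB⟩ := (hshift.v_top.eventually_lt_const (by linarith : ρm < ρm + δ)).exists
    have e1 : ∀ᶠ s in 𝓝 σ, v (B + s) < ρm + δ :=
      (hvc.comp (continuous_const.add continuous_id)).continuousAt.eventually_lt_const hB
    -- Strict order on a compact interval survives a small decrease of the shift, and comparison
    -- extends it to the line, against minimality of `σ`.
    have e2 : ∀ᶠ s in 𝓝 σ, ∀ x ∈ Icc A (B + L), u' x < u (x + s) := by
      refine isCompact_Icc.eventually_forall_of_forall_eventually fun y _ => ?_
      have c1 : Continuous fun z : ℝ × ℝ => u' z.2 := (h'.continuous_u H).comp continuous_snd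
      have c2 : Continuous fun z : ℝ × ℝ => u (z.2 + z.1) :=
        huc.comp (continuous_snd.add continuous_fst)
      exact c1.continuousAt.eventually_lt c2.continuousAt (hlt y)
    obtain ⟨s, ⟨hs1, hs2⟩, hs3⟩ :=
      (((e1.and e2).filter_mono nhdsWithin_le_nhds).and
        (self_mem_nhdsWithin : Iio σ ∈ 𝓝[<] σ)).exists
    have hsS : s ∈ S := fun x => (h.shift s).comparison H h' hδ hA hs1.le
      (fun x hx => (hs2 x hx).le) x
    exact not_lt.2 (csInf_le hbdd hsS) hs3

/-- If `u x = u y` with `x < y`, then `u` touches its translate by `y - x`, which lies above it. It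
is then periodic, which contradicts its distinct limits. -/
theorem IsFront.strictMono_u (h : IsFront J β lam ρm ρp u v) (H : TwoPhase J L β lam ρm ρp) :
    StrictMono u := by
  intro x y hxy
  have hle : ∀ z, u z ≤ u (z + (y - x)) := fun z => h.mono (by linarith)
  refine lt_of_le_of_ne (h.mono hxy.le) fun heq => ?_
  have hall := (h.shift (y - x)).eq_of_touch H h hle (x₀ := x) (by simpa using heq)
  have hn : ∀ n : ℕ, u (0 + n * (y - x)) = u 0 := by
    intro n
    induction n with
    | zero => simp
    | succ n ih => rw [← ih, hall (0 + n * (y - x))]; push_cast; congr 1; ring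
  have htop : Tendsto (fun n : ℕ => 0 + (n : ℝ) * (y - x)) atTop atTop := by
    simpa using tendsto_natCast_atTop_atTop.atTop_mul_const (sub_pos.2 hxy)
  have h1 : u 0 = ρp := by
    refine tendsto_nhds_unique ?_ (h.u_top.comp htop)
    simp only [Function.comp_def, hn]
    exact tendsto_const_nhds
  have hn' : ∀ n : ℕ, u (0 - n * (y - x)) = u 0 := by
    intro n
    induction n with
    | zero => simp
    | succ n ih => rw [← ih, hall (0 - (n + 1 : ℕ) * (y - x))]; push_cast; congr 1; ring
  have hbot : Tendsto (fun n : ℕ => 0 - (n : ℝ) * (y - x)) atTop atBot := by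
    simp only [zero_sub]
    exact tendsto_neg_atTop_atBot.comp
      (tendsto_natCast_atTop_atTop.atTop_mul_const (sub_pos.2 hxy))
  have h2 : u 0 = ρm := by
    refine tendsto_nhds_unique ?_ (h.u_bot.comp hbot)
    simp only [Function.comp_def, hn']
    exact tendsto_const_nhds
  exact H.low_lt_high.ne (h2.symm.trans h1)

theorem IsFront.strictAnti_v (h : IsFront J β lam ρm ρp u v) (H : TwoPhase J L β lam ρm ρp) :
    StrictAnti v := by
  intro x y hxy
  simpa using (h.reflect H.even).strictMono_u H (neg_lt_neg hxy)

/-- The two species cross exactly once. -/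
theorem IsFront.crossing_unique (h : IsFront J β lam ρm ρp u v) (H : TwoPhase J L β lam ρm ρp)
    {x y : ℝ} (hx : u x = v x) (hy : u y = v y) : x = y := by
  rcases lt_trichotomy x y with hlt | heq | hlt
  · linarith [h.strictMono_u H hlt, h.strictAnti_v H hlt]
  · exact heq
  · linarith [h.strictMono_u H hlt, h.strictAnti_v H hlt]

theorem IsFront.exists_crossing (h : IsFront J β lam ρm ρp u v) (H : TwoPhase J L β lam ρm ρp) :
    ∃ x, u x = v x := by
  have hρ := H.low_lt_high
  have hc : Continuous fun x => u x - v x := (h.continuous_u H).sub (h.continuous_v H)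
  obtain ⟨A, hA⟩ := ((h.u_bot.sub h.v_bot).eventually_lt_const
    (by linarith : ρm - ρp < 0)).exists
  obtain ⟨B, hB⟩ := ((h.u_top.sub h.v_top).eventually_const_lt
    (by linarith : 0 < ρp - ρm)).exists
  obtain ⟨x, hx⟩ := mem_range_of_exists_le_of_exists_ge hc ⟨A, hA.le⟩ ⟨B, hB.le⟩
  exact ⟨x, sub_eq_zero.1 hx⟩

/-- Two fronts which both cross at the origin coincide. -/
theorem IsFront.eq_of_crossing (H : TwoPhase J L β lam ρm ρp) (h : IsFront J β lam ρm ρp u v)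
    (h' : IsFront J β lam ρm ρp u' v') (h0 : u 0 = v 0) (h0' : u' 0 = v' 0) (x : ℝ) :
    u' x = u x ∧ v' x = v x := by
  obtain ⟨a, ha⟩ := h.exists_shift H h'
  have h1 : u (0 - a) = v (0 - a) := by rw [← (ha 0).1, ← (ha 0).2, h0']
  have h2 := h.crossing_unique H h1 h0
  have h3 : a = 0 := by linarith
  simpa [h3] using ha x

end Fronts

/-! ### Integrable decay and finiteness of the energy -/

/-- A bounded nonnegative antitone function which decreases by a factor `θ < 1` over the length
`K` is integrable at `+∞`. -/
theorem integrableOn_Ioi_of_contraction {p : ℝ → ℝ} {θ K X C : ℝ} (hp : Antitone p)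
    (h0 : ∀ x, 0 ≤ p x) (hC : ∀ x, p x ≤ C) (hK : 0 ≤ K) (hθ0 : 0 ≤ θ) (hθ : θ < 1)
    (h : ∀ x, X ≤ x → p x ≤ θ * p (x - K)) (a : ℝ) : IntegrableOn p (Ioi a) := by
  have hii : ∀ a b, IntervalIntegrable p volume a b := fun a b => hp.intervalIntegrable
  have hX : IntegrableOn p (Ioi X) := by
    refine integrableOn_Ioi_of_intervalIntegral_norm_bounded (θ * (K * C) / (1 - θ)) X
      (l := atTop) (b := fun x : ℝ => x) (fun i => ?_) tendsto_id ?_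
    · exact (hii X i).1
    · filter_upwards [eventually_ge_atTop X] with i hi
      have e1 : ∫ x in X..i, ‖p x‖ = ∫ x in X..i, p x := by
        refine intervalIntegral.integral_congr fun x _ => ?_
        exact abs_of_nonneg (h0 x)
      rw [e1, le_div_iff₀ (by linarith)]
      -- Writing `I` for the integral over `[X, i]`, translation by `K` gives `I ≤ θ (K C + I)`, a
      -- bound independent of `i`.
      have e2 : ∫ x in X..i, p x ≤ ∫ x in X..i, θ * p (x - K) := by
        refine intervalIntegral.integral_mono_on hi (hii _ _) ?_ fun x hx => h x hx.1
        exact Antitone.intervalIntegrable fun x y hxy =>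
          mul_le_mul_of_nonneg_left (hp (by linarith)) hθ0
      have e3 : ∫ x in X..i, θ * p (x - K) = θ * ∫ x in (X - K)..(i - K), p x := by
        rw [intervalIntegral.integral_const_mul, intervalIntegral.integral_comp_sub_right]
      have e4 : ∫ x in (X - K)..(i - K), p x
          = (∫ x in (X - K)..X, p x) + (∫ x in X..i, p x) - ∫ x in (i - K)..i, p x := by
        rw [intervalIntegral.integral_add_adjacent_intervals (hii _ _) (hii _ _),
          ← intervalIntegral.integral_add_adjacent_intervals (hii (X - K) (i - K)) (hii (i - K) i)]
        ring
      have e5 : 0 ≤ ∫ x in (i - K)..i, p x :=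
        intervalIntegral.integral_nonneg (by linarith) fun x _ => h0 x
      have e6 : ∫ x in (X - K)..X, p x ≤ K * C := by
        have := intervalIntegral.integral_mono_on (by linarith : X - K ≤ X) (hii _ _)
          (intervalIntegrable_const (c := C)) fun x _ => hC x
        simpa using this
      rw [e3, e4] at e2
      nlinarith
  have hun : IntegrableOn p (Ioc a X ∪ Ioi X) := (hii a X).1.union hX
  exact hun.mono_set fun x hx => (le_or_gt x X).imp (fun h => ⟨hx, h⟩) id

section Decay

variable {J : ℝ → ℝ} {L β lam ρm ρp : ℝ} {u v : ℝ → ℝ}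

/-- A front approaches the pure phase at `+∞` integrably, and so do the potentials. -/
theorem IsFront.integrableOn_Ioi (h : IsFront J β lam ρm ρp u v) (H : TwoPhase J L β lam ρm ρp) :
    IntegrableOn (fun x => ρp - u x) (Ioi 0) ∧ IntegrableOn (fun x => v x - ρm) (Ioi 0) ∧
    IntegrableOn (fun x => (∫ s, J s) * ρp - conv J u x) (Ioi 0) ∧
    IntegrableOn (fun x => conv J v x - (∫ s, J s) * ρm) (Ioi 0) := by
  have hJ := H.toIsKernel
  obtain ⟨δ, hδ0, hδ⟩ := H.exists_room
  have hb := H.mass_pos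
  have hβ := H.β_pos
  have hp := H.high_pos
  have hm := H.low_pos
  have hρ := H.low_lt_high
  set b := ∫ s, J s with hbdef
  have cu : ∀ x, b * ρp - conv J u x ≤ b * (ρp - u (x - L)) := by
    intro x
    have := hJ.le_conv (x := x) h.mono.measurable (h.abs_u_le H) fun y hy _ => h.mono hy
    rw [← hbdef] at this
    linarith
  have cv : ∀ x, conv J v x - b * ρm ≤ b * (v (x - L) - ρm) := by
    intro x
    have := hJ.conv_le (x := x) h.anti.measurable (h.abs_v_le H) fun y hy _ => h.anti hy
    rw [← hbdef] at this
    linarith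
  have cu0 : ∀ x, 0 ≤ b * ρp - conv J u x := fun x => sub_nonneg.2
    (hJ.conv_le h.mono.measurable (h.abs_u_le H) fun y _ _ => h.u_le_high y)
  have cv0 : ∀ x, 0 ≤ conv J v x - b * ρm := fun x => sub_nonneg.2
    (hJ.le_conv h.anti.measurable (h.abs_v_le H) fun y _ _ => h.low_le_v y)
  have q1 : ∀ x, v x - ρm ≤ v x * (β * (b * (ρp - u (x - L)))) := by
    intro x
    have h1 := response_sub_le β lam (conv J u x) (b * ρp)
    rw [← h.v_eq, H.response_high] at h1
    refine h1.trans ?_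
    have := h.low_le_v x
    have : 0 ≤ v x := by linarith
    gcongr
    exact cu x
  have p1 : ∀ x, ρp - u x ≤ ρp * (β * (b * (v (x - L) - ρm))) := by
    intro x
    have h1 := response_sub_le β lam (b * ρm) (conv J v x)
    rw [← h.u_eq, H.response_low] at h1
    refine h1.trans ?_
    gcongr
    exact cv x
  obtain ⟨B, hB⟩ := (h.v_top.eventually_lt_const (by linarith : ρm < ρm + δ)).exists
  have hanti : Antitone fun x => ρp - u x := fun x y hxy => sub_le_sub_left (h.mono hxy) _
  -- Combining `p1` and `q1` relates the deviation of `u` at `x` to that at `x - 2 L`, one range `L`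
  -- for each species.
  have key : ∀ a, IntegrableOn (fun x => ρp - u x) (Ioi a) := by
    refine integrableOn_Ioi_of_contraction (θ := (β * b) ^ 2 * ρp * (ρm + δ)) (K := 2 * L)
      (X := B + L) (C := ρp - ρm) hanti (fun x => sub_nonneg.2 (h.u_le_high x))
      (fun x => by linarith [h.low_le_u x]) (by linarith [H.range_pos]) (by positivity) hδ ?_
    intro x hx
    have h1 := p1 x
    have h2 := q1 (x - L)
    have h3 : v (x - L) ≤ ρm + δ := (h.anti (by linarith)).trans hB.le
    rw [show x - L - L = x - 2 * L by ring] at h2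
    have h4 : 0 ≤ ρp - u (x - 2 * L) := sub_nonneg.2 (h.u_le_high _)
    have h5 := mul_le_mul_of_nonneg_right h3 (by positivity : 0 ≤ β * (b * (ρp - u (x - 2 * L))))
    calc ρp - u x ≤ ρp * (β * (b * (v (x - L) - ρm))) := h1
      _ ≤ ρp * (β * (b * ((ρm + δ) * (β * (b * (ρp - u (x - 2 * L))))))) := by
        gcongr
        exact h2.trans h5
      _ = _ := by ring
  have keyL : IntegrableOn (fun x => ρp - u (x - L)) (Ioi 0) := by
    have h1 := (integrable_indicator_iff measurableSet_Ioi).2 (key (-L))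
    have h2 := h1.comp_sub_right L
    refine (integrable_indicator_iff measurableSet_Ioi).1 (h2.congr ?_)
    refine ae_of_all _ fun x => ?_
    have hx : -L < x - L ↔ 0 < x := by constructor <;> intro <;> linarith
    simp only [indicator_apply, mem_Ioi, hx]
  have kv : IntegrableOn (fun x => v x - ρm) (Ioi 0) := by
    refine (keyL.const_mul (ρp * (β * b))).mono'
      (h.anti.measurable.sub_const ρm).aestronglyMeasurable (ae_of_all _ fun x => ?_)
    have h4 : 0 ≤ ρp - u (x - L) := sub_nonneg.2 (h.u_le_high _)
    rw [Real.norm_eq_abs, abs_of_nonneg (sub_nonneg.2 (h.low_le_v x))]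
    calc v x - ρm ≤ v x * (β * (b * (ρp - u (x - L)))) := q1 x
      _ ≤ ρp * (β * (b * (ρp - u (x - L)))) := by gcongr; exact h.v_le_high x
      _ = _ := by ring
  have kvL : IntegrableOn (fun x => (ρp - u x)) (Ioi 0) := key 0
  refine ⟨kvL, kv, ?_, ?_⟩
  · refine (keyL.const_mul b).mono' ?_ (ae_of_all _ fun x => ?_)
    · exact ((hJ.conv_monotone h.mono (h.abs_u_le H)).measurable.const_sub _).aestronglyMeasurable
    · rw [Real.norm_eq_abs, abs_of_nonneg (cu0 x)]
      exact cu x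
  · refine (kvL.const_mul (1 / (β * ρm))).mono' ?_ (ae_of_all _ fun x => ?_)
    · exact ((hJ.conv_antitone h.anti (h.abs_v_le H)).measurable.sub_const _).aestronglyMeasurable
    · rw [Real.norm_eq_abs, abs_of_nonneg (cv0 x), one_div, ← div_eq_inv_mul,
        le_div_iff₀ (by positivity)]
      -- Here convexity is used in reverse: the deviation of the potential is controlled by that of
      -- `u`, because `u ≥ ρm > 0`.
      have h1 := response_sub_le β lam (conv J v x) (b * ρm)
      rw [← h.u_eq, H.response_low] at h1
      have h2 := mul_le_mul_of_nonneg_right (h.low_le_u x) (mul_nonneg hβ.le (cv0 x))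
      nlinarith

/-- The Euler–Lagrange equations remove the logarithms and leave integrable deviations from the
phase at `+∞`, multiplied by bounded factors. -/
theorem IsFront.excessDensity_eq (h : IsFront J β lam ρm ρp u v) (H : TwoPhase J L β lam ρm ρp)
    (x : ℝ) : excessDensity J β lam u v x
      = (ρp - u x) - (v x - ρm)
        + β * (v x * ((∫ s, J s) * ρp - conv J u x) - (∫ s, J s) * ρp * (v x - ρm)) := by
  have hu : Real.log (u x) = lam - 1 - β * conv J v x := by rw [h.u_eq, log_response]
  have hv : Real.log (v x) = lam - 1 - β * conv J u x := by rw [h.v_eq, log_response]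
  unfold excessDensity
  rw [integral_kernel_mul, hu, hv, H.min_eq]
  ring

/-- The excess free energy of a front is finite. -/
theorem IsFront.integrable_excessDensity (h : IsFront J β lam ρm ρp u v)
    (H : TwoPhase J L β lam ρm ρp) : Integrable (excessDensity J β lam u v) := by
  have hJ := H.toIsKernel
  have hleft : ∀ {f : ℝ → ℝ}, IntegrableOn (fun x => f (-x)) (Ioi 0) → IntegrableOn f (Iic 0) := by
    intro f hf
    rw [integrableOn_Iic_iff_integrableOn_Iio]
    have h1 := ((integrable_indicator_iff measurableSet_Ioi).2 hf).comp_neg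
    refine (integrable_indicator_iff measurableSet_Iio).1 (h1.congr (ae_of_all _ fun x => ?_))
    simp only [indicator_apply, mem_Ioi, mem_Iio, Left.neg_pos_iff, neg_neg]
  have hvm : ∀ μ : Measure ℝ, AEStronglyMeasurable v μ := fun μ =>
    h.anti.measurable.aestronglyMeasurable
  have hvb : ∀ μ : Measure ℝ, ∀ᵐ x ∂μ, ‖v x‖ ≤ ρp := fun μ => ae_of_all _ (h.abs_v_le H)
  have hright : IntegrableOn (excessDensity J β lam u v) (Ioi 0) := by
    obtain ⟨i1, i2, i3, -⟩ := h.integrableOn_Ioi H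
    rw [funext (h.excessDensity_eq H)]
    exact (i1.sub i2).add (((i3.bdd_mul (hvm _) (hvb _)).sub (i2.const_mul _)).const_mul β)
  have hl : IntegrableOn (excessDensity J β lam u v) (Iic 0) := by
    obtain ⟨i1, i2, -, i4⟩ := (h.reflect H.even).integrableOn_Ioi H
    have j1 : IntegrableOn (fun x => ρp - v x) (Iic 0) := hleft i1
    have j2 : IntegrableOn (fun x => u x - ρm) (Iic 0) := hleft i2
    have j4 : IntegrableOn (fun x => conv J u x - (∫ s, J s) * ρm) (Iic 0) := by
      refine hleft ?_
      simpa only [conv_comp_neg H.even] using i4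
    -- The same density, regrouped around the phase at `-∞`.
    refine Integrable.congr ((j1.sub j2).add
      (((j1.const_mul ((∫ s, J s) * ρm)).sub (j4.bdd_mul (hvm _) (hvb _))).const_mul β))
      (ae_of_all _ fun x => ?_)
    rw [h.excessDensity_eq H]
    simp only [Pi.add_apply, Pi.sub_apply]
    ring
  have := hl.union hright
  rwa [Iic_union_Ioi, integrableOn_univ] at this

end Decay

/-! ### The first variation and the Euler–Lagrange system -/

/-- The functions agree on a dense set, and a monotone function is squeezed between its values at
nearby points of that set. -/
theorem eq_of_monotone_of_ae_eq {f g : ℝ → ℝ} (hf : Monotone f) (hg : Continuous g)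
    (h : f =ᵐ[volume] g) (x : ℝ) : f x = g x := by
  have hd : Dense {y | f y = g y} := Measure.dense_of_ae h
  rcases lt_trichotomy (f x) (g x) with hlt | heq | hlt
  · exfalso
    obtain ⟨ε, hε, hb⟩ := Metric.eventually_nhds_iff.1 (hg.continuousAt.eventually_const_lt hlt)
    obtain ⟨y, hy, hy1, hy2⟩ := hd.exists_between (by linarith : x - ε < x)
    have h1 := hb (y := y) (by rw [Real.dist_eq, abs_lt]; constructor <;> linarith)
    have h2 := hf hy2.le
    have h3 : f y = g y := hy
    linarith
  · exact heq
  · exfalso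
    obtain ⟨ε, hε, hb⟩ := Metric.eventually_nhds_iff.1 (hg.continuousAt.eventually_lt_const hlt)
    obtain ⟨y, hy, hy1, hy2⟩ := hd.exists_between (by linarith : x < x + ε)
    have h1 := hb (y := y) (by rw [Real.dist_eq, abs_lt]; constructor <;> linarith)
    have h2 := hf hy1.le
    have h3 : f y = g y := hy
    linarith

theorem eq_of_antitone_of_ae_eq {f g : ℝ → ℝ} (hf : Antitone f) (hg : Continuous g)
    (h : f =ᵐ[volume] g) (x : ℝ) : f x = g x := by
  have := eq_of_monotone_of_ae_eq (f := fun x => -f x) (g := fun x => -g x) hf.neg hg.neg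
    (h.mono fun y hy => by simp [hy]) x
  linarith

section Variation

variable {J : ℝ → ℝ} {L β lam ρm ρp : ℝ} {u v φ ψ : ℝ → ℝ}

theorem abs_log_le {a b t : ℝ} (ha : 0 < a) (h1 : a ≤ t) (h2 : t ≤ b) :
    |Real.log t| ≤ |Real.log a| + |Real.log b| := by
  have e1 := Real.log_le_log ha h1
  have e2 := Real.log_le_log (ha.trans_le h1) h2
  have := neg_abs_le (Real.log a)
  have := le_abs_self (Real.log b)
  have := abs_nonneg (Real.log a)
  have := abs_nonneg (Real.log b)
  exact abs_le.2 ⟨by linarith, by linarith⟩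

theorem abs_conv_le (hJ : IsKernel J L) {w : ℝ → ℝ} {C : ℝ} (hw : Measurable w)
    (hb : ∀ x, |w x| ≤ C) (x : ℝ) : |conv J w x| ≤ (∫ s, J s) * C := by
  refine abs_le.2 ⟨?_, hJ.conv_le hw hb fun y _ _ => (abs_le.1 (hb y)).2⟩
  rw [← mul_neg]
  exact hJ.le_conv hw hb fun y _ _ => (abs_le.1 (hb y)).1

/-- The first variation of the excess free energy. -/
theorem hasDerivAt_excessDifference (H : TwoPhase J L β lam ρm ρp) (hu : Monotone u)
    (hv : Antitone v) (hu1 : ∀ x, ρm ≤ u x) (hu2 : ∀ x, u x ≤ ρp) (hv1 : ∀ x, ρm ≤ v x)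
    (hv2 : ∀ x, v x ≤ ρp) (hφ : Continuous φ) (hφs : HasCompactSupport φ) (hψ : Continuous ψ)
    (hψs : HasCompactSupport ψ) :
    HasDerivAt (fun ε : ℝ => excessDifference J β lam u v
        (fun x => u x + ε * φ x) (fun x => v x + ε * ψ x))
      (∫ x, (φ x * (Real.log (u x) + 1 - lam + β * conv J v x)
        + ψ x * (Real.log (v x) + 1 - lam + β * conv J u x))) 0 := by
  have hJ := H.toIsKernel
  have hp := H.high_pos
  have hm := H.low_pos
  have hρ := H.low_lt_high
  have hβ := H.β_pos
  have hb := H.mass_pos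
  set b := ∫ s, J s with hbdef
  have hub : ∀ x, |u x| ≤ ρp := fun x => H.abs_le (hu1 x) (hu2 x)
  have hvb : ∀ x, |v x| ≤ ρp := fun x => H.abs_le (hv1 x) (hv2 x)
  obtain ⟨Cφ, hCφ⟩ := hφ.bounded_above_of_compact_support hφs
  obtain ⟨Cψ, hCψ⟩ := hψ.bounded_above_of_compact_support hψs
  simp only [Real.norm_eq_abs] at hCφ hCψ
  set C := max Cφ Cψ with hC
  have hCφ' : ∀ x, |φ x| ≤ C := fun x => (hCφ x).trans (le_max_left _ _)
  have hCψ' : ∀ x, |ψ x| ≤ C := fun x => (hCψ x).trans (le_max_right _ _)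
  have hC0 : 0 ≤ C := (abs_nonneg _).trans (hCφ' 0)
  have iφ : Integrable φ := hφ.integrable_of_hasCompactSupport hφs
  have iψ : Integrable ψ := hψ.integrable_of_hasCompactSupport hψs
  have icψ : Integrable (conv J ψ) := by
    simpa using (integrable_mul_conv_and_symm (u := fun _ => 1) (C := 1) hJ.integrable hJ.even
      measurable_const (by simp) iψ).2.1
  have mcv : Measurable (conv J v) := (hJ.conv_antitone hv hvb).measurable
  have mcψ : Measurable (conv J ψ) := by
    refine (continuous_conv hJ.integrable hψ.measurable hCψ' ?_).measurable
    simp [hψ.continuousAt]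
  have mu := hu.measurable
  have mv := hv.measurable
  have mφ := hφ.measurable
  have mψ := hψ.measurable
  have hcadd : ∀ ε x, conv J (fun y => v y + ε * ψ y) x = conv J v x + ε * conv J ψ x := by
    intro ε x
    rw [conv_add (C' := |ε| * C) hJ.integrable mv hvb (mψ.const_mul ε) (fun y => ?_),
      conv_const_mul]
    rw [abs_mul]
    exact mul_le_mul_of_nonneg_left (hCψ' y) (abs_nonneg _)
  set F : ℝ → ℝ → ℝ := fun ε x =>
    (u x + ε * φ x) * Real.log (u x + ε * φ x) + (v x + ε * ψ x) * Real.log (v x + ε * ψ x)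
    + β * ((u x + ε * φ x) * (conv J v x + ε * conv J ψ x))
    - lam * ((u x + ε * φ x) + (v x + ε * ψ x))
    - (u x * Real.log (u x) + v x * Real.log (v x) + β * (u x * conv J v x)
      - lam * (u x + v x)) with hF
  have hFeq : (fun ε : ℝ => excessDifference J β lam u v
      (fun x => u x + ε * φ x) (fun x => v x + ε * ψ x)) = fun ε => ∫ x, F ε x := by
    funext ε
    unfold excessDifference
    congr 1
    funext x
    simp only [excessDensity, integral_kernel_mul, hcadd, hF]
    ring
  set F' : ℝ → ℝ → ℝ := fun ε x =>
    φ x * (Real.log (u x + ε * φ x) + 1) + ψ x * (Real.log (v x + ε * ψ x) + 1)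
    + β * (φ x * (conv J v x + ε * conv J ψ x) + (u x + ε * φ x) * conv J ψ x)
    - lam * (φ x + ψ x) with hF'
  -- For `|ε| < ε₀` the perturbed densities stay in `[ρm / 2, 2 ρp]`, where the logarithm is
  -- bounded; the `1` in `C + 1` avoids division by zero.
  set ε₀ := min 1 (ρm / 2 / (C + 1)) with hε₀
  have hε₀pos : 0 < ε₀ := lt_min one_pos (by positivity)
  have hε₀C : ε₀ * C ≤ ρm / 2 := by
    have h1 : ε₀ ≤ ρm / 2 / (C + 1) := min_le_right _ _
    rw [le_div_iff₀ (by linarith)] at h1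
    nlinarith
  have hpert : ∀ {ε t w : ℝ}, |ε| < ε₀ → ρm ≤ w → w ≤ ρp → |t| ≤ C →
      ρm / 2 ≤ w + ε * t ∧ w + ε * t ≤ 2 * ρp := by
    intro ε t w hε h1 h2 h3
    have h4 : |ε * t| ≤ ρm / 2 := by
      rw [abs_mul]
      exact (mul_le_mul hε.le h3 (abs_nonneg _) hε₀pos.le).trans hε₀C
    have := abs_le.1 h4
    exact ⟨by linarith, by linarith⟩
  set K := |Real.log (ρm / 2)| + |Real.log (2 * ρp)| with hK
  have hK0 : 0 ≤ K := by positivity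
  have hmain := hasDerivAt_integral_of_dominated_loc_of_deriv_le (μ := volume) (F := F) (F' := F')
    (x₀ := (0 : ℝ)) (s := Metric.ball 0 ε₀)
    (bound := fun x => |φ x| * (K + 1) + |ψ x| * (K + 1)
      + β * (|φ x| * (b * ρp + b * C) + 2 * ρp * |conv J ψ x|) + |lam| * (|φ x| + |ψ x|))
    (Metric.ball_mem_nhds 0 hε₀pos) ?_ ?_ ?_ ?_ ?_ ?_
  · rw [hFeq]
    obtain ⟨hi, hd⟩ := hmain
    refine hd.congr_deriv ?_
    have hsw := integrable_mul_conv_and_symm hJ.integrable hJ.even mu hub iψ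
    -- Pointwise differentiation produces `u (J * ψ)`; symmetry of the quadratic form exchanges it
    -- for `ψ (J * u)` under the integral.
    have hz : ∫ x, β * (u x * conv J ψ x - ψ x * conv J u x) = 0 := by
      rw [integral_const_mul, integral_sub hsw.2.1 hsw.1, hsw.2.2, sub_self, mul_zero]
    have hi2 : Integrable fun x => β * (u x * conv J ψ x - ψ x * conv J u x) :=
      (hsw.2.1.sub hsw.1).const_mul β
    have hsub : ∫ x, F' 0 x = ∫ x, (F' 0 x - β * (u x * conv J ψ x - ψ x * conv J u x)) := by
      rw [integral_sub hi hi2, hz, sub_zero]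
    rw [hsub]
    congr 1
    funext x
    simp only [hF', zero_mul, add_zero]
    ring
  · refine Eventually.of_forall fun ε => Measurable.aestronglyMeasurable ?_
    simp only [hF]
    fun_prop
  · simp only [hF, zero_mul, add_zero, sub_self]
    exact integrable_zero _ _ _
  · refine Measurable.aestronglyMeasurable ?_
    simp only [hF']
    fun_prop
  · refine ae_of_all _ fun x ε hε => ?_
    have hε' : |ε| < ε₀ := by simpa using hε
    obtain ⟨a1, a2⟩ := hpert hε' (hu1 x) (hu2 x) (hCφ' x)
    obtain ⟨b1, b2⟩ := hpert hε' (hv1 x) (hv2 x) (hCψ' x)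
    have l1 := abs_log_le (by linarith) a1 a2
    have l2 := abs_log_le (by linarith) b1 b2
    have c1 : |Real.log (u x + ε * φ x) + 1| ≤ K + 1 := (abs_add_le _ _).trans (by simpa using l1)
    have c2 : |Real.log (v x + ε * ψ x) + 1| ≤ K + 1 := (abs_add_le _ _).trans (by simpa using l2)
    have c3 : |conv J v x + ε * conv J ψ x| ≤ b * ρp + b * C := by
      refine (abs_add_le _ _).trans (add_le_add (abs_conv_le hJ mv hvb x) ?_)
      rw [abs_mul]
      have h1 : |ε| ≤ 1 := hε'.le.trans (min_le_left _ _)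
      have h2 := abs_conv_le hJ mψ hCψ' x
      have := abs_nonneg (conv J ψ x)
      nlinarith
    have c4 : |u x + ε * φ x| ≤ 2 * ρp := abs_le.2 ⟨by linarith, a2⟩
    rw [Real.norm_eq_abs]
    refine (abs_sub _ _).trans (add_le_add ((abs_add_le _ _).trans (add_le_add
      ((abs_add_le _ _).trans (add_le_add ?_ ?_)) ?_)) ?_)
    · rw [abs_mul]; gcongr
    · rw [abs_mul]; gcongr
    · rw [abs_mul, abs_of_pos hβ]
      refine mul_le_mul_of_nonneg_left ((abs_add_le _ _).trans (add_le_add ?_ ?_)) hβ.le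
      · rw [abs_mul]; gcongr
      · rw [abs_mul]; gcongr
    · rw [abs_mul]
      gcongr
      exact abs_add_le _ _
  · exact (((iφ.abs.mul_const _).add (iψ.abs.mul_const _)).add
      (((iφ.abs.mul_const _).add (icψ.abs.const_mul _)).const_mul β)).add
      ((iφ.abs.add iψ.abs).const_mul _)
  · refine ae_of_all _ fun x ε hε => ?_
    have hε' : |ε| < ε₀ := by simpa using hε
    obtain ⟨a1, -⟩ := hpert hε' (hu1 x) (hu2 x) (hCφ' x)
    obtain ⟨b1, -⟩ := hpert hε' (hv1 x) (hv2 x) (hCψ' x)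
    have dlin : ∀ s t : ℝ, HasDerivAt (fun ε : ℝ => s + ε * t) t ε := fun s t => by
      simpa using ((hasDerivAt_id ε).mul_const t).const_add s
    have d1 := (Real.hasDerivAt_mul_log (by linarith : u x + ε * φ x ≠ 0)).comp ε (dlin (u x) (φ x))
    have d2 := (Real.hasDerivAt_mul_log (by linarith : v x + ε * ψ x ≠ 0)).comp ε (dlin (v x) (ψ x))
    have d3 := ((dlin (u x) (φ x)).mul (dlin (conv J v x) (conv J ψ x))).const_mul β
    have d4 := ((dlin (u x) (φ x)).add (dlin (v x) (ψ x))).const_mul lam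
    refine ((((d1.add d2).add d3).sub d4).sub_const (u x * Real.log (u x)
      + v x * Real.log (v x) + β * (u x * conv J v x) - lam * (u x + v x))).congr_deriv ?_
    simp only [hF']
    ring

/-- The critical points of the excess free energy are the fronts. -/
theorem isCriticalPoint_iff (H : TwoPhase J L β lam ρm ρp) :
    IsCriticalPoint J β lam ρm ρp u v ↔ IsFront J β lam ρm ρp u v := by
  have hJ := H.toIsKernel
  constructor
  · rintro ⟨⟨⟨mu, ubot, utop⟩, hu⟩, ⟨⟨mv, vbot, vtop⟩, hv⟩, hcrit⟩
    have hu1 : ∀ x, ρm ≤ u x := hu.le_of_tendsto ubot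
    have hu2 : ∀ x, u x ≤ ρp := hu.ge_of_tendsto utop
    have hv1 : ∀ x, ρm ≤ v x := hv.le_of_tendsto vtop
    have hv2 : ∀ x, v x ≤ ρp := hv.ge_of_tendsto vbot
    have hub : ∀ x, |u x| ≤ ρp := fun x => H.abs_le (hu1 x) (hu2 x)
    have hvb : ∀ x, |v x| ≤ ρp := fun x => H.abs_le (hv1 x) (hv2 x)
    have hu0 : ∀ x, 0 < u x := fun x => H.low_pos.trans_le (hu1 x)
    have hv0 : ∀ x, 0 < v x := fun x => H.low_pos.trans_le (hv1 x)
    have ccu : Continuous (conv J u) :=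
      continuous_conv hJ.integrable mu hub hu.countable_not_continuousAt
    have ccv : Continuous (conv J v) :=
      continuous_conv hJ.integrable mv hvb hv.countable_not_continuousAt
    have lu : LocallyIntegrable (fun x => Real.log (u x)) :=
      Monotone.locallyIntegrable fun x y hxy => Real.log_le_log (hu0 x) (hu hxy)
    have lv : LocallyIntegrable (fun x => Real.log (v x)) :=
      Antitone.locallyIntegrable fun x y hxy => Real.log_le_log (hv0 y) (hv hxy)
    have cont1 : Continuous fun x => 1 - lam + β * conv J v x := by fun_prop
    have cont2 : Continuous fun x => 1 - lam + β * conv J u x := by fun_prop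
    -- Varying one species at a time isolates each equation.
    have e1 := ae_eq_zero_of_integral_contDiff_smul_eq_zero (lu.add cont1.locallyIntegrable)
      fun φ hφ hφs => by
        have h1 := hcrit φ (fun _ => 0) hφ hφs contDiff_const HasCompactSupport.zero
        have h2 := hasDerivAt_excessDifference (ψ := fun _ => (0 : ℝ)) H hu hv hu1 hu2 hv1 hv2
          hφ.continuous hφs
          continuous_const HasCompactSupport.zero
        rw [← h2.unique h1]
        congr 1; funext x
        simp only [smul_eq_mul, Pi.add_apply]; ring
    have e2 := ae_eq_zero_of_integral_contDiff_smul_eq_zero (lv.add cont2.locallyIntegrable)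
      fun φ hφ hφs => by
        have h1 := hcrit (fun _ => 0) φ contDiff_const HasCompactSupport.zero hφ hφs
        have h2 := hasDerivAt_excessDifference (φ := fun _ => (0 : ℝ)) H hu hv hu1 hu2 hv1 hv2
          continuous_const HasCompactSupport.zero hφ.continuous hφs
        rw [← h2.unique h1]
        congr 1; funext x
        simp only [smul_eq_mul, Pi.add_apply]; ring
    refine ⟨hu, hv, ubot, utop, vbot, vtop, ?_, ?_⟩
    · refine eq_of_monotone_of_ae_eq hu ((continuous_response β lam).comp ccv) ?_
      filter_upwards [e1] with x hx
      rw [← Real.exp_log (hu0 x)]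
      simp only [Pi.add_apply] at hx
      simp only [response]
      congr 1; linarith
    · refine eq_of_antitone_of_ae_eq hv ((continuous_response β lam).comp ccu) ?_
      filter_upwards [e2] with x hx
      rw [← Real.exp_log (hv0 x)]
      simp only [Pi.add_apply] at hx
      simp only [response]
      congr 1; linarith
  · intro h
    refine ⟨⟨⟨h.mono.measurable, h.u_bot, h.u_top⟩, h.mono⟩,
      ⟨⟨h.anti.measurable, h.v_bot, h.v_top⟩, h.anti⟩, fun φ ψ hφ hφs hψ hψs => ?_⟩
    refine (hasDerivAt_excessDifference H h.mono h.anti h.low_le_u h.u_le_high h.low_le_v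
      h.v_le_high hφ.continuous hφs hψ.continuous hψs).congr_deriv ?_
    have hz : ∀ x, φ x * (Real.log (u x) + 1 - lam + β * conv J v x)
        + ψ x * (Real.log (v x) + 1 - lam + β * conv J u x) = 0 := by
      intro x
      rw [h.u_eq x, h.v_eq x, log_response, log_response]
      ring
    simp only [hz, integral_zero]

end Variation

/-! ### Compactness, Fatou and entropy tools -/

/-- Helly's selection theorem for uniformly bounded monotone functions on the line. -/
theorem exists_monotone_subseq_tendsto {W : ℕ → ℝ → ℝ} {a b : ℝ} (hW : ∀ k, Monotone (W k))
    (ha : ∀ k x, a ≤ W k x) (hb : ∀ k x, W k x ≤ b) :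
    ∃ (u : ℝ → ℝ) (σ : ℕ → ℕ), StrictMono σ ∧ Monotone u ∧
      ∀ x, ContinuousAt u x → Tendsto (fun k => W (σ k) x) atTop (𝓝 (u x)) := by
  have hK : IsCompact (Set.pi univ fun _ : ℚ => Icc a b) := isCompact_univ_pi fun _ => isCompact_Icc
  -- The product over the countable set `ℚ` is sequentially compact, so one subsequence converges at
  -- all rationals.
  obtain ⟨r, -, σ, hσ, hr⟩ := hK.tendsto_subseq (x := fun k (q : ℚ) => W k q)
    fun k q _ => ⟨ha k q, hb k q⟩
  have hq : ∀ q : ℚ, Tendsto (fun k => W (σ k) q) atTop (𝓝 (r q)) := fun q =>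
    (tendsto_pi_nhds.1 hr) q
  -- The upper limit is defined at every point and inherits monotonicity, with no need for
  -- convergence.
  set u : ℝ → ℝ := fun x => limsup (fun k => W (σ k) x) atTop with hu
  have hbdd : ∀ x, IsBoundedUnder (· ≤ ·) atTop (fun k => W (σ k) x) := fun x =>
    isBoundedUnder_of ⟨b, fun k => hb _ _⟩
  have hcobdd : ∀ x, IsCoboundedUnder (· ≤ ·) atTop (fun k => W (σ k) x) := fun x =>
    (isBoundedUnder_of ⟨a, fun k => ha _ _⟩ :
      IsBoundedUnder (· ≥ ·) atTop (fun k => W (σ k) x)).isCoboundedUnder_le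
  have huq : ∀ q : ℚ, u q = r q := fun q => (hq q).limsup_eq
  refine ⟨u, σ, hσ, ?_, ?_⟩
  · intro x y hxy
    exact limsup_le_limsup (Eventually.of_forall fun k => hW _ hxy) (hcobdd x) (hbdd y)
  · intro x hx
    refine tendsto_order.2 ⟨fun c hc => ?_, fun c hc => ?_⟩
    · obtain ⟨ε, hε, h⟩ := Metric.eventually_nhds_iff.1 (hx.eventually_const_lt hc)
      obtain ⟨q, hq1, hq2⟩ := exists_rat_btwn (by linarith : x - ε < x)
      have h1 := h (y := (q : ℝ)) (by rw [Real.dist_eq, abs_lt]; constructor <;> linarith)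
      rw [huq] at h1
      filter_upwards [(hq q).eventually_const_lt h1] with k hk
      exact hk.trans_le (hW _ hq2.le)
    · obtain ⟨ε, hε, h⟩ := Metric.eventually_nhds_iff.1 (hx.eventually_lt_const hc)
      obtain ⟨q, hq1, hq2⟩ := exists_rat_btwn (by linarith : x < x + ε)
      have h1 := h (y := (q : ℝ)) (by rw [Real.dist_eq, abs_lt]; constructor <;> linarith)
      rw [huq] at h1
      filter_upwards [(hq q).eventually_lt_const h1] with k hk
      exact (hW _ hq1.le).trans_lt hk

/-- Fatou's lemma for real-valued functions with converging bounds on the integrals. -/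
theorem lintegral_ofReal_le_of_tendsto {f : ℕ → ℝ → ℝ} {g : ℝ → ℝ} {c : ℕ → ℝ} {C : ℝ}
    (hf : ∀ k, Integrable (f k)) (h0 : ∀ k x, 0 ≤ f k x) (hc : ∀ k, ∫ x, f k x ≤ c k)
    (hC : Tendsto c atTop (𝓝 C)) (hfg : ∀ᵐ x, Tendsto (fun k => f k x) atTop (𝓝 (g x))) :
    ∫⁻ x, ENNReal.ofReal (g x) ≤ ENNReal.ofReal C := by
  have e1 : ∫⁻ x, ENNReal.ofReal (g x)
      = ∫⁻ x, liminf (fun k => ENNReal.ofReal (f k x)) atTop := by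
    refine lintegral_congr_ae ?_
    filter_upwards [hfg] with x hx
    exact ((ENNReal.continuous_ofReal.tendsto _).comp hx).liminf_eq.symm
  rw [e1]
  refine (lintegral_liminf_le' fun k => (hf k).aestronglyMeasurable.aemeasurable.ennreal_ofReal).trans
    ?_
  rw [← ((ENNReal.continuous_ofReal.tendsto _).comp hC).liminf_eq]
  refine liminf_le_liminf (Eventually.of_forall fun k => ?_)
  simp only [Function.comp]
  rw [← ofReal_integral_eq_lintegral_ofReal (hf k) (ae_of_all _ (h0 k))]
  exact ENNReal.ofReal_le_ofReal (hc k)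

/-- A function with finite integral has no positive limit along sets of infinite measure. -/
theorem not_tendsto_pos_of_lintegral_lt_top {g : ℝ → ℝ} {l : Filter ℝ}
    (hl : ∀ s ∈ l, volume s = ⊤) (hm : Measurable g) (hg : ∫⁻ x, ENNReal.ofReal (g x) < ⊤) {c : ℝ} (hc : 0 < c) :
    ¬ Tendsto g l (𝓝 c) := by
  intro h
  have h1 := hl {x | ENNReal.ofReal (c / 2) ≤ ENNReal.ofReal (g x)} <| by
    filter_upwards [h.eventually_const_lt (by linarith : c / 2 < c)] with x hx
    exact ENNReal.ofReal_le_ofReal hx.le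
  have h2 := mul_meas_ge_le_lintegral (μ := volume) hm.ennreal_ofReal (ENNReal.ofReal (c / 2))
  rw [h1, ENNReal.mul_top (by simpa using hc)] at h2
  exact absurd hg (not_lt.2 h2)

theorem integrable_of_bounded_of_eq_zero {f : ℝ → ℝ} {C R : ℝ} (hf : Measurable f)
    (hC : ∀ x, |f x| ≤ C) (h : ∀ x, R < |x| → f x = 0) : Integrable f := by
  have hs : Function.support f ⊆ Icc (-R) R := by
    intro x hx
    by_contra hcon
    refine hx (h x ?_)
    by_contra hle
    exact hcon (abs_le.1 (not_lt.1 hle))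
  rw [← integrableOn_iff_integrable_of_support_subset hs]
  exact Measure.integrableOn_of_bounded (M := C) (by simp) hf.aestronglyMeasurable
    (ae_of_all _ hC)

/-- Relative entropy dominates the squared Hellinger distance. -/
theorem sq_sqrt_sub_le {a b : ℝ} (ha : 0 < a) (hb : 0 < b) :
    (√a - √b) ^ 2 ≤ a * (Real.log a - Real.log b) - a + b := by
  have sa := Real.sqrt_pos.2 ha
  have sb := Real.sqrt_pos.2 hb
  have e1 := Real.sq_sqrt ha.le
  have e2 := Real.sq_sqrt hb.le
  -- Applying `log t ≤ t - 1` at `t = √b / √a` and multiplying by `2 a` gives the bound.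
  have h1 := Real.log_le_sub_one_of_pos (div_pos sb sa)
  rw [Real.log_div sb.ne' sa.ne', Real.log_sqrt ha.le, Real.log_sqrt hb.le] at h1
  have h2 := mul_le_mul_of_nonneg_left h1 ha.le
  have h3 : a * (√b / √a - 1) = √a * √b - a := by
    field_simp
    nlinarith
  rw [h3] at h2
  nlinarith

/-! ### Alternating equilibration of the two species -/

section Existence

variable {J : ℝ → ℝ} {L β lam ρm ρp : ℝ} {u v : ℝ → ℝ}

/-- The density of the other species in equilibrium with `u`. -/
def partner (J : ℝ → ℝ) (β lam : ℝ) (u : ℝ → ℝ) (x : ℝ) : ℝ := response β lam (conv J u x)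

/-- Equilibrating each species in turn. -/
def update (J : ℝ → ℝ) (β lam : ℝ) (u : ℝ → ℝ) : ℝ → ℝ := partner J β lam (partner J β lam u)

/-- The excess free energy density minimized over the second species. -/
def reducedDensity (J : ℝ → ℝ) (β lam : ℝ) (u : ℝ → ℝ) (x : ℝ) : ℝ :=
  u x * Real.log (u x) - lam * u x - partner J β lam u x
    - minLocalFreeEnergy β (∫ s, J s) lam

/-- Monotone profiles between the two phases which are constant outside a bounded set. -/
structure IsTransition (ρm ρp : ℝ) (R : ℝ) (u : ℝ → ℝ) : Prop where
  mono : Monotone u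
  low_le : ∀ x, ρm ≤ u x
  le_high : ∀ x, u x ≤ ρp
  left : ∀ x, x < -R → u x = ρm
  right : ∀ x, R < x → u x = ρp

theorem TwoPhase.low_le_partner (H : TwoPhase J L β lam ρm ρp) (hu : Measurable u)
    (h1 : ∀ x, ρm ≤ u x) (h2 : ∀ x, u x ≤ ρp) (x : ℝ) : ρm ≤ partner J β lam u x := by
  rw [← H.response_high]
  exact response_antitone H.β_pos.le lam (H.conv_le hu (fun x => H.abs_le (h1 x) (h2 x))
    fun y _ _ => h2 y)

theorem TwoPhase.partner_le_high (H : TwoPhase J L β lam ρm ρp) (hu : Measurable u)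
    (h1 : ∀ x, ρm ≤ u x) (h2 : ∀ x, u x ≤ ρp) (x : ℝ) : partner J β lam u x ≤ ρp := by
  rw [← H.response_low]
  exact response_antitone H.β_pos.le lam (H.le_conv hu (fun x => H.abs_le (h1 x) (h2 x))
    fun y _ _ => h1 y)

theorem TwoPhase.partner_antitone (H : TwoPhase J L β lam ρm ρp) (hu : Monotone u)
    (h1 : ∀ x, ρm ≤ u x) (h2 : ∀ x, u x ≤ ρp) : Antitone (partner J β lam u) := fun _ _ hxy =>
  response_antitone H.β_pos.le lam (H.conv_monotone hu (fun x => H.abs_le (h1 x) (h2 x)) hxy)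

theorem TwoPhase.partner_monotone (H : TwoPhase J L β lam ρm ρp) (hu : Antitone u)
    (h1 : ∀ x, ρm ≤ u x) (h2 : ∀ x, u x ≤ ρp) : Monotone (partner J β lam u) := fun _ _ hxy =>
  response_antitone H.β_pos.le lam (H.conv_antitone hu (fun x => H.abs_le (h1 x) (h2 x)) hxy)

/-- Updated monotone profiles are monotone profiles. -/
theorem TwoPhase.update_mono (H : TwoPhase J L β lam ρm ρp) (hu : Monotone u)
    (h1 : ∀ x, ρm ≤ u x) (h2 : ∀ x, u x ≤ ρp) :
    Monotone (update J β lam u) ∧ (∀ x, ρm ≤ update J β lam u x) ∧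
      (∀ x, update J β lam u x ≤ ρp) ∧ Continuous (update J β lam u) := by
  have a := H.partner_antitone hu h1 h2
  have b1 := H.low_le_partner hu.measurable h1 h2
  have b2 := H.partner_le_high hu.measurable h1 h2
  exact ⟨H.partner_monotone a b1 b2, H.low_le_partner a.measurable b1 b2,
    H.partner_le_high a.measurable b1 b2, (continuous_response β lam).comp
      (continuous_conv H.integrable a.measurable (fun x => H.abs_le (b1 x) (b2 x))
        a.countable_not_continuousAt)⟩

theorem partner_eq_of_eq (hJ : IsKernel J L) (hu : Measurable u) {C c : ℝ} (hb : ∀ x, |u x| ≤ C)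
    {x : ℝ} (h : ∀ y, x - L ≤ y → y ≤ x + L → u y = c) :
    partner J β lam u x = response β lam ((∫ s, J s) * c) := by
  unfold partner
  rw [le_antisymm (hJ.conv_le hu hb fun y h1 h2 => (h y h1 h2).le)
    (hJ.le_conv hu hb fun y h1 h2 => (h y h1 h2).ge)]

theorem partner_comp_add (J : ℝ → ℝ) (β lam : ℝ) (u : ℝ → ℝ) (a x : ℝ) :
    partner J β lam (fun y => u (y + a)) x = partner J β lam u (x + a) := by
  unfold partner; rw [conv_comp_add]

theorem update_comp_add (J : ℝ → ℝ) (β lam : ℝ) (u : ℝ → ℝ) (a x : ℝ) :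
    update J β lam (fun y => u (y + a)) x = update J β lam u (x + a) := by
  unfold update
  rw [← partner_comp_add]
  congr 1; funext y
  exact partner_comp_add J β lam u a y

theorem TwoPhase.log_low (H : TwoPhase J L β lam ρm ρp) :
    Real.log ρm = lam - 1 - β * ((∫ s, J s) * ρp) := by
  conv_lhs => rw [← H.response_high]
  exact log_response _ _ _

theorem TwoPhase.log_high (H : TwoPhase J L β lam ρm ρp) :
    Real.log ρp = lam - 1 - β * ((∫ s, J s) * ρm) := by
  conv_lhs => rw [← H.response_low]
  exact log_response _ _ _

theorem TwoPhase.well_low (H : TwoPhase J L β lam ρm ρp) :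
    wellEnergy β (∫ s, J s) lam ρm = 0 := by
  unfold wellEnergy; rw [H.response_low, H.log_low, H.min_eq]; ring

theorem TwoPhase.well_high (H : TwoPhase J L β lam ρm ρp) :
    wellEnergy β (∫ s, J s) lam ρp = 0 := by
  unfold wellEnergy; rw [H.response_high, H.log_high, H.min_eq]; ring

theorem TwoPhase.well_nonneg (H : TwoPhase J L β lam ρm ρp) {m : ℝ} (h1 : ρm ≤ m) (h2 : m ≤ ρp) :
    0 ≤ wellEnergy β (∫ s, J s) lam m := by
  rcases h1.eq_or_lt with rfl | h1
  · exact H.well_low.ge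
  rcases h2.eq_or_lt with rfl | h2
  · exact H.well_high.ge
  exact (H.well_pos m ⟨h1, h2⟩).le

theorem continuous_wellEnergy (β Jhat lam : ℝ) : Continuous (wellEnergy β Jhat lam) := by
  have := Real.continuous_mul_log
  have := continuous_response β lam
  unfold wellEnergy
  fun_prop

/-- Each equilibration sees only distance `L` and exchanges the phases; two of them restore the
phases and cost `2 L`. -/
theorem IsTransition.update {R : ℝ} (H : TwoPhase J L β lam ρm ρp) (h : IsTransition ρm ρp R u) :
    IsTransition ρm ρp (R + 2 * L) (update J β lam u) := by
  obtain ⟨m, b1, b2, -⟩ := H.update_mono h.mono h.low_le h.le_high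
  have hub : ∀ x, |u x| ≤ ρp := fun x => H.abs_le (h.low_le x) (h.le_high x)
  have a := H.partner_antitone h.mono h.low_le h.le_high
  have hvb : ∀ x, |partner J β lam u x| ≤ ρp := fun x => H.abs_le
    (H.low_le_partner h.mono.measurable h.low_le h.le_high x)
    (H.partner_le_high h.mono.measurable h.low_le h.le_high x)
  have hJ := H.toIsKernel
  refine ⟨m, b1, b2, fun x hx => ?_, fun x hx => ?_⟩
  · refine (partner_eq_of_eq hJ a.measurable hvb (c := ρp) fun y _ hy => ?_).trans H.response_high
    exact (partner_eq_of_eq hJ h.mono.measurable hub (c := ρm) fun z _ hz =>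
      h.left z (by linarith)).trans H.response_low
  · refine (partner_eq_of_eq hJ a.measurable hvb (c := ρm) fun y hy _ => ?_).trans H.response_low
    exact (partner_eq_of_eq hJ h.mono.measurable hub (c := ρp) fun z hz _ =>
      h.right z (by linarith)).trans H.response_high

end Existence

/-! ### Energy estimates along the iteration -/

section Energy

variable {J : ℝ → ℝ} {L β lam ρm ρp R : ℝ} {u : ℝ → ℝ}

/-- This separates the local well from a nonlocal correction, which vanishes wherever `u` is
constant over the interaction range. -/
theorem reducedDensity_eq (J : ℝ → ℝ) (β lam : ℝ) (u : ℝ → ℝ) (x : ℝ) :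
    reducedDensity J β lam u x = wellEnergy β (∫ s, J s) lam (u x)
      + (response β lam ((∫ s, J s) * u x) - partner J β lam u x) := by
  unfold reducedDensity wellEnergy; ring

theorem IsTransition.abs_le_high (H : TwoPhase J L β lam ρm ρp) (h : IsTransition ρm ρp R u) (x : ℝ) :
    |u x| ≤ ρp := H.abs_le (h.low_le x) (h.le_high x)

theorem IsTransition.mono_range {R' : ℝ} (h : IsTransition ρm ρp R u) (hR : R ≤ R') :
    IsTransition ρm ρp R' u :=
  ⟨h.mono, h.low_le, h.le_high, fun x hx => h.left x (by linarith),
    fun x hx => h.right x (by linarith)⟩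

theorem IsTransition.integrable_well (H : TwoPhase J L β lam ρm ρp)
    (h : IsTransition ρm ρp R u) : Integrable fun x => wellEnergy β (∫ s, J s) lam (u x) := by
  have hc := continuous_wellEnergy β (∫ s, J s) lam
  obtain ⟨C, hC⟩ := (isCompact_Icc (a := ρm) (b := ρp)).exists_bound_of_continuousOn hc.continuousOn
  refine integrable_of_bounded_of_eq_zero (R := R) (hc.measurable.comp h.mono.measurable)
    (fun x => hC _ ⟨h.low_le x, h.le_high x⟩) fun x hx => ?_
  rcases lt_abs.1 hx with hx | hx
  · rw [h.right x hx, H.well_high]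
  · rw [h.left x (by linarith), H.well_low]

theorem IsTransition.integrable_reducedDensity (H : TwoPhase J L β lam ρm ρp)
    (h : IsTransition ρm ρp R u) : Integrable (reducedDensity J β lam u) := by
  rw [funext (reducedDensity_eq J β lam u)]
  have hJ := H.toIsKernel
  have hp := H.partner_antitone h.mono h.low_le h.le_high
  refine (h.integrable_well H).add (integrable_of_bounded_of_eq_zero (R := R + L) (C := ρp) ?_
    (fun x => ?_) fun x hx => ?_)
  · exact ((continuous_response β lam).measurable.comp (h.mono.measurable.const_mul _)).sub
      hp.measurable
  · have a1 := H.low_le_partner h.mono.measurable h.low_le h.le_high x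
    have a2 := H.partner_le_high h.mono.measurable h.low_le h.le_high x
    have b1 : response β lam ((∫ s, J s) * u x) ≤ ρp := by
      rw [← H.response_low]
      exact response_antitone H.β_pos.le lam (mul_le_mul_of_nonneg_left (h.low_le x) H.mass_pos.le)
    have b2 := (response_pos β lam ((∫ s, J s) * u x)).le
    have := H.low_pos
    exact abs_le.2 ⟨by linarith, by linarith⟩
  · have hL := H.range_pos
    rcases lt_abs.1 hx with hx | hx
    · rw [partner_eq_of_eq hJ h.mono.measurable (h.abs_le_high H) (c := ρp)
        fun y _ _ => h.right y (by linarith), h.right x (by linarith), sub_self]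
    · rw [partner_eq_of_eq hJ h.mono.measurable (h.abs_le_high H) (c := ρm)
        fun y _ _ => h.left y (by linarith), h.left x (by linarith), sub_self]

theorem IsTransition.integrable_sq_sqrt (H : TwoPhase J L β lam ρm ρp)
    (h : IsTransition ρm ρp R u) :
    Integrable fun x => (√(u x) - √(BinaryFluid.update J β lam u x)) ^ 2 := by
  have hL := H.range_pos
  have h' := h.update H
  have hR : IsTransition ρm ρp (R + 2 * L) u := h.mono_range (by linarith)
  refine integrable_of_bounded_of_eq_zero (R := R + 2 * L) (C := 2 * ρp) ?_ (fun x => ?_)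
    fun x hx => ?_
  · exact (h.mono.measurable.sqrt.sub h'.mono.measurable.sqrt).pow_const 2
  · have e1 := Real.sq_sqrt (H.low_pos.le.trans (h.low_le x))
    have e2 := Real.sq_sqrt (H.low_pos.le.trans (h'.low_le x))
    have s1 := Real.sqrt_nonneg (u x)
    have s2 := Real.sqrt_nonneg (BinaryFluid.update J β lam u x)
    rw [abs_of_nonneg (sq_nonneg _)]
    nlinarith [h.le_high x, h'.le_high x, mul_nonneg s1 s2]
  · rcases lt_abs.1 hx with hx | hx
    · rw [hR.right x hx, h'.right x hx]; simp
    · rw [hR.left x (by linarith), h'.left x (by linarith)]; simp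

/-- Equilibrating the two species in turn lowers the free energy. -/
theorem IsTransition.energy_decrease (H : TwoPhase J L β lam ρm ρp)
    (h : IsTransition ρm ρp R u) :
    (∫ x, reducedDensity J β lam (BinaryFluid.update J β lam u) x)
      + ∫ x, (√(u x) - √(BinaryFluid.update J β lam u x)) ^ 2
      ≤ ∫ x, reducedDensity J β lam u x := by
  have hJ := H.toIsKernel
  have hL := H.range_pos
  have h' := h.update H
  have hR : IsTransition ρm ρp (R + 2 * L) u := h.mono_range (by linarith)
  set w := BinaryFluid.update J β lam u with hw
  set v := partner J β lam u with hv
  have hva := H.partner_antitone h.mono h.low_le h.le_high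
  have hvb : ∀ x, |v x| ≤ ρp := fun x => H.abs_le
    (H.low_le_partner h.mono.measurable h.low_le h.le_high x)
    (H.partner_le_high h.mono.measurable h.low_le h.le_high x)
  have hd : Integrable fun x => u x - w x := by
    refine integrable_of_bounded_of_eq_zero (R := R + 2 * L) (C := ρp + ρp)
      (h.mono.measurable.sub h'.mono.measurable)
      (fun x => (abs_sub _ _).trans (add_le_add (h.abs_le_high H x) (h'.abs_le_high H x))) fun x hx => ?_
    rcases lt_abs.1 hx with hx | hx
    · rw [hR.right x hx, h'.right x hx, sub_self]
    · rw [hR.left x (by linarith), h'.left x (by linarith), sub_self]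
  obtain ⟨i1, i2, i3⟩ := integrable_mul_conv_and_symm hJ.integrable hJ.even hva.measurable hvb hd
  -- Relative entropy of `u` with respect to `w` gives the Hellinger term and convexity of `Φ`
  -- handles the partners. The remaining linear terms are antisymmetric and integrate to zero.
  have hpt : ∀ x, reducedDensity J β lam w x + (√(u x) - √(w x)) ^ 2
      + β * (v x * conv J (fun y => u y - w y) x - (u x - w x) * conv J v x)
      ≤ reducedDensity J β lam u x := by
    intro x
    have u0 := H.low_pos.trans_le (h.low_le x)
    have w0 := H.low_pos.trans_le (h'.low_le x)
    have a1 := sq_sqrt_sub_le u0 w0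
    have a2 : Real.log (w x) = lam - 1 - β * conv J v x := by
      rw [hw]; unfold BinaryFluid.update; unfold partner; rw [log_response]; rfl
    have a3 := response_sub_le β lam (conv J u x) (conv J w x)
    rw [conv_sub hJ.integrable h.mono.measurable (h.abs_le_high H) h'.mono.measurable (h'.abs_le_high H)]
    have a4 : v x = response β lam (conv J u x) := rfl
    have a5 : partner J β lam w x = response β lam (conv J w x) := rfl
    unfold reducedDensity
    rw [← hv, a5]
    rw [← a4] at a3
    rw [a2] at a1 ⊢
    nlinarith
  have j1 := h'.integrable_reducedDensity H
  have j2 := h.integrable_sq_sqrt H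
  have j3 : Integrable fun x =>
      β * (v x * conv J (fun y => u y - w y) x - (u x - w x) * conv J v x) :=
    (i2.sub i1).const_mul β
  have hint := integral_mono ((j1.add j2).add j3) (h.integrable_reducedDensity H) hpt
  have e0 : ∫ x, β * (v x * conv J (fun y => u y - w y) x - (u x - w x) * conv J v x) = 0 := by
    rw [integral_const_mul, integral_sub i2 i1, i3, sub_self, mul_zero]
  have e1 := integral_add (j1.add j2) j3
  have e2 := integral_add j1 j2
  simp only [Pi.add_apply] at hint e1 e2
  rw [e1, e2, e0, add_zero] at hint
  exact hint

/-- The free energy controls the local part of the energy. -/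
theorem IsTransition.integral_well_le (H : TwoPhase J L β lam ρm ρp)
    (h : IsTransition ρm ρp R u) :
    ∫ x, wellEnergy β (∫ s, J s) lam (u x)
      ≤ (∫ x, reducedDensity J β lam u x) + ρp * (β * (∫ s, J s)) * (2 * L * ρp) := by
  have hJ := H.toIsKernel
  have hL := H.range_pos
  have hβ := H.β_pos
  have hp := H.high_pos
  have hb := H.mass_pos
  set b := ∫ s, J s with hbdef
  -- By convexity of `Φ` and monotonicity of `u`, the nonlocal correction is controlled by the
  -- increment of `u` over one interaction window.
  have hpt : ∀ x, wellEnergy β b lam (u x)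
      ≤ reducedDensity J β lam u x + ρp * (β * b) * (u (x + L) - u (x - L)) := by
    intro x
    have h1 := response_sub_le β lam (conv J u x) (b * u x)
    have h2 : b * u (x - L) ≤ conv J u x :=
      hJ.le_conv h.mono.measurable (h.abs_le_high H) fun y hy _ => h.mono hy
    have h3 : u x ≤ u (x + L) := h.mono (by linarith)
    have h4 := H.partner_le_high h.mono.measurable h.low_le h.le_high x
    have h5 : partner J β lam u x = response β lam (conv J u x) := rfl
    rw [reducedDensity_eq, ← hbdef]
    rw [← h5] at h1
    have h6 : partner J β lam u x * (β * (b * u x - conv J u x))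
        ≤ ρp * (β * (b * (u (x + L) - u (x - L)))) := by
      have h7 : b * u x - conv J u x ≤ b * (u (x + L) - u (x - L)) := by nlinarith
      have h8 : u (x - L) ≤ u (x + L) := h.mono (by linarith)
      have h9 : 0 ≤ b * (u (x + L) - u (x - L)) := mul_nonneg hb.le (by linarith)
      have h10 : 0 ≤ partner J β lam u x := (response_pos _ _ _).le
      exact (mul_le_mul_of_nonneg_left (mul_le_mul_of_nonneg_left h7 hβ.le) h10).trans
        (mul_le_mul_of_nonneg_right h4 (mul_nonneg hβ.le h9))
    nlinarith
  have hsupp : ∀ x, R + L < |x| → u (x + L) - u (x - L) = 0 := by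
    intro x hx
    rcases lt_abs.1 hx with hx | hx
    · rw [h.right _ (by linarith), h.right _ (by linarith), sub_self]
    · rw [h.left _ (by linarith), h.left _ (by linarith), sub_self]
  have hm1 : Monotone fun x => u (x + L) := fun x y hxy => h.mono (by linarith)
  have hm2 : Monotone fun x => u (x - L) := fun x y hxy => h.mono (by linarith)
  have hwi : Integrable fun x => u (x + L) - u (x - L) :=
    integrable_of_bounded_of_eq_zero (C := ρp + ρp) (hm1.measurable.sub hm2.measurable)
      (fun x => (abs_sub _ _).trans (add_le_add (h.abs_le_high H _) (h.abs_le_high H _))) hsupp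
  have hii : ∀ a b, IntervalIntegrable u volume a b := fun a b => h.mono.intervalIntegrable
  -- The integral telescopes to end windows of length `2 L`, so the bound does not depend on `R`.
  have hle : ∫ x, (u (x + L) - u (x - L)) ≤ 2 * L * ρp := by
    set M := R + L + 1 with hM
    have hs : Function.support (fun x => u (x + L) - u (x - L)) ⊆ Ioc (-M) M := by
      intro x hx
      have h1 : |x| ≤ R + L := not_lt.1 fun hlt => hx (hsupp x hlt)
      have := abs_le.1 h1
      exact ⟨by linarith, by linarith⟩
    rw [← intervalIntegral.integral_eq_integral_of_support_subset hs,
      intervalIntegral.integral_sub hm1.intervalIntegrable hm2.intervalIntegrable,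
      intervalIntegral.integral_comp_add_right, intervalIntegral.integral_comp_sub_right]
    have e1 := intervalIntegral.integral_add_adjacent_intervals (hii (-M - L) (-M + L))
      (hii (-M + L) (M + L))
    have e2 := intervalIntegral.integral_add_adjacent_intervals (hii (-M - L) (M - L))
      (hii (M - L) (M + L))
    have e3 : 0 ≤ ∫ x in (-M - L)..(-M + L), u x :=
      intervalIntegral.integral_nonneg (by linarith) fun x _ => H.low_pos.le.trans (h.low_le x)
    have e4 := intervalIntegral.integral_mono_on (by linarith : M - L ≤ M + L) (hii _ _)
      (intervalIntegrable_const (c := ρp)) fun x _ => h.le_high x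
    rw [intervalIntegral.integral_const, smul_eq_mul] at e4
    have e5 : (M + L - (M - L)) * ρp = 2 * L * ρp := by ring
    linarith
  have j := h.integrable_reducedDensity H
  have hint := integral_mono (h.integrable_well H) (j.add (hwi.const_mul (ρp * (β * b)))) hpt
  have e1 := integral_add j (hwi.const_mul (ρp * (β * b)))
  simp only [Pi.add_apply] at hint e1
  rw [e1, integral_const_mul] at hint
  have := mul_le_mul_of_nonneg_left hle (by positivity : 0 ≤ ρp * (β * b))
  linarith

end Energy

/-! ### Passage to the limit and existence of fronts -/

section Limit

variable {J : ℝ → ℝ} {L β lam ρm ρp : ℝ}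

/-- The sharp interface. -/
def sharpInterface (ρm ρp x : ℝ) : ℝ := if x < 0 then ρm else ρp

theorem isTransition_sharpInterface (hρ : ρm ≤ ρp) :
    IsTransition ρm ρp 0 (sharpInterface ρm ρp) := by
  unfold sharpInterface
  refine ⟨fun x y hxy => ?_, fun x => ?_, fun x => ?_, fun x hx => ?_, fun x hx => ?_⟩
  · split_ifs <;> linarith
  · split_ifs <;> linarith
  · split_ifs <;> linarith
  · rw [if_pos (by linarith)]
  · rw [if_neg (by linarith)]

/-- A centred sequence of monotone profiles of bounded energy which asymptotically solves the
Euler–Lagrange equations. -/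
theorem TwoPhase.exists_approximate_fronts (H : TwoPhase J L β lam ρm ρp) :
    ∃ (W : ℕ → ℝ → ℝ) (C : ℝ),
      (∀ k, Monotone (W k) ∧ (∀ x, ρm ≤ W k x) ∧ (∀ x, W k x ≤ ρp) ∧
        W k 0 = (ρm + ρp) / 2 ∧
        Integrable (fun x => wellEnergy β (∫ s, J s) lam (W k x)) ∧
        ∫ x, wellEnergy β (∫ s, J s) lam (W k x) ≤ C ∧
        Integrable fun x => (√(W k x) - √(update J β lam (W k) x)) ^ 2) ∧
      Tendsto (fun k => ∫ x, (√(W k x) - √(update J β lam (W k) x)) ^ 2) atTop (𝓝 0) := by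
  have hL := H.range_pos
  have hρ := H.low_lt_high
  set U : ℕ → ℝ → ℝ := fun k => (update J β lam)^[k] (sharpInterface ρm ρp) with hU
  have hUs : ∀ k, U (k + 1) = update J β lam (U k) := fun k => Function.iterate_succ_apply' _ _ _
  have hT : ∀ k, ∃ R, IsTransition ρm ρp R (U k) := by
    intro k
    induction k with
    | zero => exact ⟨0, isTransition_sharpInterface hρ.le⟩
    | succ k ih =>
      obtain ⟨R, hR⟩ := ih
      exact ⟨_, hUs k ▸ hR.update H⟩
  choose R hR using hT
  set E : ℕ → ℝ := fun k => ∫ x, reducedDensity J β lam (U k) x with hE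
  set a : ℕ → ℝ := fun k => ∫ x, (√(U k x) - √(update J β lam (U k) x)) ^ 2 with ha
  have ha0 : ∀ k, 0 ≤ a k := fun k => integral_nonneg fun x => sq_nonneg _
  have hdec : ∀ k, E (k + 1) + a k ≤ E k := by
    intro k
    simp only [hE, ha, hUs]
    exact (hR k).energy_decrease H
  set D := ρp * (β * (∫ s, J s)) * (2 * L * ρp) with hD
  have hwell : ∀ k, ∫ x, wellEnergy β (∫ s, J s) lam (U k x) ≤ E k + D := fun k =>
    (hR k).integral_well_le H
  have hw0 : ∀ k, 0 ≤ ∫ x, wellEnergy β (∫ s, J s) lam (U k x) := fun k =>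
    integral_nonneg fun x => H.well_nonneg ((hR k).low_le x) ((hR k).le_high x)
  have hsum : ∀ n, ∑ k ∈ Finset.range n, a k ≤ E 0 - E n := by
    intro n
    induction n with
    | zero => simp
    | succ n ih => rw [Finset.sum_range_succ]; linarith [hdec n]
  have hE0 : ∀ n, E n ≤ E 0 := fun n => by
    have := Finset.sum_nonneg fun k (_ : k ∈ Finset.range n) => ha0 k
    linarith [hsum n]
  -- The decrements are summable: nonnegativity of the well energy gives `E n ≥ -D`.
  have hlim : Tendsto a atTop (𝓝 0) :=
    (summable_of_sum_range_le (c := E 0 + D) ha0 fun n => by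
      linarith [hsum n, hw0 n, hwell n]).tendsto_atTop_zero
  -- The index begins at `k + 1` because the sharp interface is discontinuous and may miss the
  -- midpoint value.
  have hs : ∀ k, ∃ s, U (k + 1) s = (ρm + ρp) / 2 := by
    intro k
    have hc : Continuous (U (k + 1)) := by
      rw [hUs]
      exact (H.update_mono (hR k).mono (hR k).low_le (hR k).le_high).2.2.2
    exact mem_range_of_exists_le_of_exists_ge hc
      ⟨-R (k + 1) - 1, by rw [(hR (k + 1)).left _ (by linarith)]; linarith⟩
      ⟨R (k + 1) + 1, by rw [(hR (k + 1)).right _ (by linarith)]; linarith⟩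
  choose s hs using hs
  have hsq : ∀ k, (fun x => (√(U (k + 1) (x + s k))
      - √(update J β lam (fun y => U (k + 1) (y + s k)) x)) ^ 2)
      = fun x => (fun z => (√(U (k + 1) z) - √(update J β lam (U (k + 1)) z)) ^ 2) (x + s k) := by
    intro k
    funext x
    rw [update_comp_add]
  refine ⟨fun k x => U (k + 1) (x + s k), E 0 + D, fun k => ⟨?_, ?_, ?_, ?_, ?_, ?_, ?_⟩, ?_⟩
  · exact fun x y hxy => (hR (k + 1)).mono (by linarith)
  · exact fun x => (hR (k + 1)).low_le _
  · exact fun x => (hR (k + 1)).le_high _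
  · simpa using hs k
  · exact ((hR (k + 1)).integrable_well H).comp_add_right (s k)
  · rw [integral_add_right_eq_self (fun x => wellEnergy β (∫ s, J s) lam (U (k + 1) x)) (s k)]
    linarith [hwell (k + 1), hE0 (k + 1)]
  · rw [hsq]
    exact ((hR (k + 1)).integrable_sq_sqrt H).comp_add_right (s k)
  · simp only [hsq]
    refine ((tendsto_add_atTop_iff_nat 1).2 hlim).congr fun k => ?_
    exact (integral_add_right_eq_self (fun z => (√(U (k + 1) z)
      - √(update J β lam (U (k + 1)) z)) ^ 2) (s k)).symm

/-- A bounded monotone fixed point of the update map of finite energy is a front. -/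
theorem TwoPhase.isFront_of_fixed (H : TwoPhase J L β lam ρm ρp) {u : ℝ → ℝ} (hu : Monotone u)
    (h1 : ∀ x, ρm ≤ u x) (h2 : ∀ x, u x ≤ ρp) (hfix : ∀ x, update J β lam u x = u x)
    (hE : ∫⁻ x, ENNReal.ofReal (wellEnergy β (∫ s, J s) lam (u x)) < ⊤)
    {x₁ x₂ : ℝ} (hx₁ : u x₁ < ρp) (hx₂ : ρm < u x₂) :
    IsFront J β lam ρm ρp u (partner J β lam u) := by
  have hc := continuous_wellEnergy β (∫ s, J s) lam
  have hm := hc.measurable.comp hu.measurable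
  have bA : BddAbove (range u) := ⟨ρp, by rintro _ ⟨x, rfl⟩; exact h2 x⟩
  have bB : BddBelow (range u) := ⟨ρm, by rintro _ ⟨x, rfl⟩; exact h1 x⟩
  have t1 := tendsto_atTop_ciSup hu bA
  have t2 := tendsto_atBot_ciInf hu bB
  have hub : ∀ x, |u x| ≤ ρp := fun x => H.abs_le (h1 x) (h2 x)
  have top : (⨆ x, u x) = ρp := by
    have g1 : ρm < ⨆ x, u x := hx₂.trans_le (le_ciSup bA x₂)
    have g2 : (⨆ x, u x) ≤ ρp := ciSup_le h2
    rcases g2.eq_or_lt with g2 | g2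
    · exact g2
    -- A limit strictly between the phases has positive well energy, so the integral would diverge
    -- on a half-line.
    · refine absurd ((hc.tendsto _).comp t1) (not_tendsto_pos_of_lintegral_lt_top (fun s hs => ?_)
        hm hE (H.well_pos _ ⟨g1, g2⟩))
      obtain ⟨N, hN⟩ := mem_atTop_sets.1 hs
      exact measure_mono_top (fun x hx => hN x hx : Ici N ⊆ s) Real.volume_Ici
  have bot : (⨅ x, u x) = ρm := by
    have g1 : (⨅ x, u x) < ρp := (ciInf_le bB x₁).trans_lt hx₁
    have g2 : ρm ≤ ⨅ x, u x := le_ciInf h1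
    rcases g2.eq_or_lt with g2 | g2
    · exact g2.symm
    · refine absurd ((hc.tendsto _).comp t2) (not_tendsto_pos_of_lintegral_lt_top (fun s hs => ?_)
        hm hE (H.well_pos _ ⟨g2, g1⟩))
      obtain ⟨N, hN⟩ := mem_atBot_sets.1 hs
      exact measure_mono_top (fun x hx => hN x hx : Iic N ⊆ s) Real.volume_Iic
  rw [top] at t1
  rw [bot] at t2
  have r := continuous_response β lam
  refine ⟨hu, H.partner_antitone hu h1 h2, t2, t1, ?_, ?_, fun x => (hfix x).symm, fun x => rfl⟩
  · have := (r.tendsto _).comp (tendsto_conv_atBot H.integrable hu.measurable hub t2)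
    rwa [H.response_low] at this
  · have := (r.tendsto _).comp (tendsto_conv_atTop H.integrable hu.measurable hub t1)
    rwa [H.response_high] at this

/-- Fronts exist. -/
theorem TwoPhase.exists_isFront (H : TwoPhase J L β lam ρm ρp) :
    ∃ u v, IsFront J β lam ρm ρp u v := by
  have hρ := H.low_lt_high
  obtain ⟨W, C, hW, hlim⟩ := H.exists_approximate_fronts
  choose mW aW bW cW iW eW sW using hW
  obtain ⟨u, σ, hσ, hu, hconv⟩ := exists_monotone_subseq_tendsto mW aW bW
  have hae : ∀ᵐ x, Tendsto (fun k => W (σ k) x) atTop (𝓝 (u x)) := by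
    filter_upwards [hu.countable_not_continuousAt.ae_notMem volume] with x hx
    exact hconv x (not_not.1 hx)
  have hlow : ∀ᵐ x, ρm ≤ u x := hae.mono fun x hx => ge_of_tendsto' hx fun k => aW _ x
  have hpart : ∀ x, Tendsto (fun k => partner J β lam (W (σ k)) x) atTop
      (𝓝 (partner J β lam u x)) := by
    intro x
    refine ((continuous_response β lam).tendsto _).comp ?_
    refine tendsto_conv (F := fun k => W (σ k)) (y := fun _ => x) (C := ρp) H.integrable
      (fun k => (mW _).measurable) (fun k y => H.abs_le (aW _ y) (bW _ y)) ?_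
    exact (Measure.measurePreserving_sub_left volume x).quasiMeasurePreserving.ae hae
  have hupd : ∀ x, Tendsto (fun k => update J β lam (W (σ k)) x) atTop
      (𝓝 (update J β lam u x)) := by
    intro x
    refine ((continuous_response β lam).tendsto _).comp ?_
    refine tendsto_conv (F := fun k => partner J β lam (W (σ k))) (y := fun _ => x) (C := ρp)
      H.integrable (fun k => (H.partner_antitone (mW _) (aW _) (bW _)).measurable)
      (fun k y => H.abs_le (H.low_le_partner (mW _).measurable (aW _) (bW _) y)
        (H.partner_le_high (mW _).measurable (aW _) (bW _) y)) ?_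
    exact ae_of_all _ fun s => hpart _
  have t1 : ∀ x, ρm ≤ update J β lam u x := fun x => ge_of_tendsto' (hupd x) fun k =>
    (H.update_mono (mW _) (aW _) (bW _)).2.1 x
  have t2 : ∀ x, update J β lam u x ≤ ρp := fun x => le_of_tendsto' (hupd x) fun k =>
    (H.update_mono (mW _) (aW _) (bW _)).2.2.1 x
  have t3 : Monotone (update J β lam u) := fun x y hxy =>
    le_of_tendsto_of_tendsto' (hupd x) (hupd y) fun k =>
      (H.update_mono (mW _) (aW _) (bW _)).1 hxy
  -- Fatou's lemma passes the vanishing Hellinger distances to the limit.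
  have hfix : u =ᵐ[volume] update J β lam u := by
    have h0 := lintegral_ofReal_le_of_tendsto (fun k => sW (σ k)) (fun k x => sq_nonneg _)
      (fun k => le_rfl) (hlim.comp hσ.tendsto_atTop)
      (g := fun x => (√(u x) - √(update J β lam u x)) ^ 2) <| by
        filter_upwards [hae] with x hx
        exact (((Real.continuous_sqrt.tendsto _).comp hx).sub
          ((Real.continuous_sqrt.tendsto _).comp (hupd x))).pow 2
    have hmeas : Measurable fun x => ENNReal.ofReal ((√(u x) - √(update J β lam u x)) ^ 2) :=
      ((hu.measurable.sqrt.sub t3.measurable.sqrt).pow_const 2).ennreal_ofReal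
    rw [ENNReal.ofReal_zero, nonpos_iff_eq_zero, lintegral_eq_zero_iff hmeas] at h0
    filter_upwards [h0, hlow] with x hx hlx
    have h1 : (√(u x) - √(update J β lam u x)) ^ 2 ≤ 0 := ENNReal.ofReal_eq_zero.1 hx
    have h2 : √(u x) - √(update J β lam u x) = 0 := by
      have := le_antisymm h1 (sq_nonneg _)
      simpa using this
    exact (Real.sqrt_inj (H.low_pos.le.trans hlx) (H.low_pos.le.trans (t1 x))).1 (sub_eq_zero.1 h2)
  -- Potentials ignore null sets, so replacing `u` by its update gives a fixed point at every point.
  have hfix' : ∀ x, update J β lam (update J β lam u) x = update J β lam u x := by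
    intro x
    have h1 : partner J β lam (update J β lam u) = partner J β lam u := by
      funext y
      unfold partner
      rw [conv_congr_ae hfix]
    show partner J β lam (partner J β lam (update J β lam u)) x = _
    rw [h1]
    rfl
  have hE : ∫⁻ x, ENNReal.ofReal (wellEnergy β (∫ s, J s) lam (update J β lam u x)) < ⊤ := by
    refine lt_of_le_of_lt (lintegral_ofReal_le_of_tendsto (fun k => iW (σ k))
      (fun k x => H.well_nonneg (aW _ x) (bW _ x)) (fun k => eW (σ k)) tendsto_const_nhds ?_)
      ENNReal.ofReal_lt_top
    filter_upwards [hae, hfix] with x hx hfx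
    rw [← hfx]
    exact ((continuous_wellEnergy β (∫ s, J s) lam).tendsto _).comp hx
  have hdense : Dense {x | Tendsto (fun k => W (σ k) x) atTop (𝓝 (u x)) ∧
      u x = update J β lam u x} := Measure.dense_of_ae (hae.and hfix)
  -- The centring is read off at good points on both sides of the origin, since convergence at the
  -- origin itself is not guaranteed. This excludes a constant limit equal to either phase.
  obtain ⟨x₁, ⟨hx₁, hx₁'⟩, -, hneg⟩ := hdense.exists_between (by norm_num : (-1 : ℝ) < 0)
  obtain ⟨x₂, ⟨hx₂, hx₂'⟩, hpos, -⟩ := hdense.exists_between (by norm_num : (0 : ℝ) < 1)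
  have e1 : u x₁ ≤ (ρm + ρp) / 2 := le_of_tendsto' hx₁ fun k =>
    (mW (σ k) hneg.le).trans (cW _).le
  have e2 : (ρm + ρp) / 2 ≤ u x₂ := ge_of_tendsto' hx₂ fun k =>
    (cW (σ k)).ge.trans (mW (σ k) hpos.le)
  exact ⟨_, _, H.isFront_of_fixed t3 t1 t2 hfix' hE (x₁ := x₁) (x₂ := x₂) (by linarith)
    (by linarith)⟩

end Limit

/-! ### Assembly -/

theorem exists_isKernel {J : ℝ → ℝ} (hJ_nonneg : ∀ x, 0 ≤ J x) (hJ_even : ∀ x, J (-x) = J x)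
    (hJ_decr : AntitoneOn J (Ioi 0)) (hJ_supp : HasCompactSupport J) (hJ_int : Integrable J) :
    ∃ L, IsKernel J L := by
  obtain ⟨r, hr⟩ := hJ_supp.isCompact.isBounded.subset_closedBall 0
  -- The maximum with `1` makes the range positive even if the support is trivial.
  refine ⟨max r 1, hJ_nonneg, hJ_even, hJ_decr, hJ_int, lt_max_of_lt_right one_pos, fun s hs => ?_⟩
  by_contra hne
  have h1 := hr (subset_tsupport J hne)
  rw [mem_closedBall_zero_iff, Real.norm_eq_abs] at h1
  exact not_lt.2 (h1.trans (le_max_left _ _)) hs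

end BinaryFluid

end

theorem mainTheorem1
    (J : ℝ → ℝ)
    (hJ_nonneg : ∀ x, 0 ≤ J x)
    (hJ_even : ∀ x, J (-x) = J x)
    (hJ_decr : AntitoneOn J (Set.Ioi 0))
    (hJ_supp : HasCompactSupport J)
    (hJ_int : MeasureTheory.Integrable J)
    (β lam ρm ρp : ℝ) (hβ : 0 < β)
    (hρm : 0 ≤ ρm) (hρ : ρm < ρp)
    (hmin : IsMinOn
      (fun p : ℝ × ℝ => BinaryFluid.localFreeEnergy β (∫ s, J s) lam p.1 p.2)
      (Set.Ici 0 ×ˢ Set.Ici 0) (ρm, ρp))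
    (hmin' : IsMinOn
      (fun p : ℝ × ℝ => BinaryFluid.localFreeEnergy β (∫ s, J s) lam p.1 p.2)
      (Set.Ici 0 ×ˢ Set.Ici 0) (ρp, ρm)) :
    (∀ w₁ w₂ : ℝ → ℝ, BinaryFluid.IsCriticalPoint J β lam ρm ρp w₁ w₂ →
      MeasureTheory.Integrable (BinaryFluid.excessDensity J β lam w₁ w₂)) ∧
    (∀ w₁ w₂ v₁ v₂ : ℝ → ℝ,
      BinaryFluid.IsCriticalPoint J β lam ρm ρp w₁ w₂ →
      BinaryFluid.IsCriticalPoint J β lam ρm ρp v₁ v₂ →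
      ∃ a : ℝ, ∀ x : ℝ, (v₁ x, v₂ x) = (w₁ (x - a), w₂ (x - a))) ∧
    (∃! w : (ℝ → ℝ) × (ℝ → ℝ),
      BinaryFluid.IsCriticalPoint J β lam ρm ρp w.1 w.2 ∧ w.1 0 = w.2 0) ∧
    (∀ w₁ w₂ : ℝ → ℝ, BinaryFluid.IsCriticalPoint J β lam ρm ρp w₁ w₂ →
      w₁ 0 = w₂ 0 → ∀ x : ℝ, w₁ x = w₂ (-x)) := by
  obtain ⟨L, hJ⟩ := BinaryFluid.exists_isKernel hJ_nonneg hJ_even hJ_decr hJ_supp hJ_int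
  have H := BinaryFluid.TwoPhase.of_isMinOn hJ hβ hρm hρ hmin
  simp only [BinaryFluid.isCriticalPoint_iff H]
  refine ⟨fun w₁ w₂ h => h.integrable_excessDensity H, fun w₁ w₂ v₁ v₂ h h' => ?_, ?_,
    fun w₁ w₂ h h0 x => ?_⟩
  · obtain ⟨a, ha⟩ := h.exists_shift H h'
    exact ⟨a, fun x => Prod.ext (ha x).1 (ha x).2⟩
  · obtain ⟨u, v, h⟩ := H.exists_isFront
    obtain ⟨s, hs⟩ := h.exists_crossing H
    refine ⟨(fun x => u (x + s), fun x => v (x + s)), ⟨h.shift s, by simpa using hs⟩, ?_⟩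
    rintro ⟨u', v'⟩ ⟨h', h0'⟩
    have key := (h.shift s).eq_of_crossing H h' (by simpa using hs) h0'
    exact Prod.ext (funext fun x => (key x).1) (funext fun x => (key x).2)
  -- The reflected front also crosses at the origin, hence coincides with the original.
  · exact ((h.reflect hJ_even).eq_of_crossing H h (by simpa using h0.symm) h0 x).1
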